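/- For $d\ge 1$ let $\mathcal P_d(\mathbb R)$ be the set of monic polynomials of degree $d$ with real coefficients and only real roots. Write $p\in\mathcal P_d(\mathbb R)$ as $p(x)=\sum_{k=0}^d x^{d-k}(-1)^k\binom dk e_k(p)$. The finite-free additive convolution of $p,q\in\mathcal P_d(\mathbb R)$ is $$[p\boxplus_d q](x)=\sum_{k=0}^d x^{d-k}(-1)^k\binom dk\Big[\sum_{i=0}^k\binom ki e_i(p)\,e_{k-i}(q)\Big].$$ For $p\in\mathcal P_d(\mathbb R)$ let $\mu_p$ be its root distribution, the probability measure putting mass $1/d$ at each root, counted with multiplicity. For a measure $\mu$ on $\mathbb R$ write $m_n(\mu)=\int t^n\,d\mu(t)$. Let $\mu$ be a probability measure on $\mathbb R$ with finite moments of all orders and $\mu':\mathbb R[x]\to\mathbb R$ a linear functional. A sequence $\mathfrak p=(p_d)_{d\ge1}$ with $p_d\in\mathcal P_d(\mathbb R)$ has infinitesimal distribution $(\mu,\mu')$ if for every $n\ge0$ $$m_n(\mu_{p_d})\to m_n(\mu)\quad\text{and}\quad d\,\big(m_n(\mu_{p_d})-m_n(\mu)\big)\to\mu'(x^n)\qquad(d\to\infty);$$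 in particular $\mu'(1)=0$. Let $NC(n)$ be the set of non-crossing partitions of $\{1,\dots,n\}$. The free cumulants $(r_n(\mu))_{n\ge1}$ and the infinitesimal free cumulants $(r'_n(\mu,\mu'))_{n\ge1}$ are defined recursively by $$m_n(\mu)=\sum_{\pi\in NC(n)}\prod_{V\in\pi}r_{|V|}(\mu),\qquad \mu'(x^n)=\sum_{\pi\in NC(n)}\sum_{V\in\pi}r'_{|V|}(\mu,\mu')\prod_{W\in\pi,\,W\ne V}r_{|W|}(\mu)\qquad(n\ge1).$$ A pair $(\gamma,\gamma')$, with $\gamma$ a probability measure on $\mathbb R$ with finite moments of all orders and $\gamma':\mathbb R[x]\to\mathbb R$ linear with $\gamma'(1)=0$, is an infinitesimal free additive convolution $(\mu,\mu')\boxplus_B(\nu,\nu')$ if $r_n(\gamma)=r_n(\mu)+r_n(\nu)$ (that is, $\gamma=\mu\boxplus\nu$) and $r'_n(\gamma,\gamma')=r'_n(\mu,\mu')+r'_n(\nu,\nu')$ for all $n\ge1$. These conditions determine $\gamma'$ and the moments of $\gamma$. **Corollary.** Suppose that $\mathfrak p=(p_d)_{d\ge1}$ and $\mathfrak q=(q_d)_{d\ge1}$,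 with $p_d,q_d\in\mathcal P_d(\mathbb R)$, have infinitesimal distributions $(\mu,\mu')$ and $(\nu,\nu')$, respectively, and that $\nu=\delta_0$. Then an infinitesimal free additive convolution $(\mu,\mu')\boxplus_B(\nu,\nu')$ exists, and for every such pair $(\gamma,\gamma')$ the sequence $\mathfrak p\boxplus\mathfrak q=(p_d\boxplus_d q_d)_{d\ge1}$ has infinitesimal distribution $(\gamma,\gamma')$; in particular $p_d\boxplus_d q_d\in\mathcal P_d(\mathbb R)$ for every $d\ge1$. -/

import Mathlib

open Polynomial MeasureTheory Filter Topology

namespace FiniteFree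

/-! ### Real-rooted polynomials, root distributions, finite-free additive convolution -/

/-- `p` is a monic real polynomial of degree `d`, all of whose roots are real. -/
structure IsMonicRealRooted (d : ℕ) (p : ℝ[X]) : Prop where
  monic : p.Monic
  natDegree_eq : p.natDegree = d
  splits : p.Splits

/-- The root distribution of `p`: each root, counted with multiplicity, carries mass
`1 / deg p`. -/
noncomputable def rootDistribution (p : ℝ[X]) : Measure ℝ :=
  (p.natDegree : ENNReal)⁻¹ • (p.roots.map fun a : ℝ => Measure.dirac a).sum

/-- The `n`-th moment `∫ tⁿ dμ(t)`. -/
noncomputable def mom (μ : Measure ℝ) (n : ℕ) : ℝ :=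
  ProbabilityTheory.moment (fun t : ℝ => t) n μ

/-- The normalized coefficient `eₖ(p)` of a polynomial of degree `d`, that is,
`p(x) = ∑ₖ x^(d-k) (-1)^k (d choose k) eₖ(p)`; it is used only for `k ≤ d`. -/
noncomputable def normCoeff (d : ℕ) (p : ℝ[X]) (k : ℕ) : ℝ :=
  (-1) ^ k * p.coeff (d - k) / (d.choose k : ℝ)

/-- The finite-free additive convolution of two polynomials of degree `d`. -/
noncomputable def addConv (d : ℕ) (p q : ℝ[X]) : ℝ[X] :=
  ∑ k ∈ Finset.range (d + 1),
    C ((-1) ^ k * (d.choose k : ℝ) *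
      ∑ i ∈ Finset.range (k + 1), (k.choose i : ℝ) * normCoeff d p i * normCoeff d q (k - i))
    * X ^ (d - k)

/-! ### Infinitesimal distributions of sequences of polynomials -/

/-- `μ` is a probability measure on `ℝ` with finite moments of all orders. -/
structure IsLawWithMoments (μ : Measure ℝ) : Prop where
  isProb : IsProbabilityMeasure μ
  integrable : ∀ n : ℕ, Integrable (fun t : ℝ => t ^ n) μ

/-- The sequence `(p d)` for `d ≥ 1` consists of monic real-rooted polynomials with `deg (p d) = d`
and has limiting root distribution `μ`, in the sense of convergence of moments. -/
structure HasLimitingDistribution (p : ℕ → ℝ[X]) (μ : Measure ℝ) : Prop where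
  realRooted : ∀ d : ℕ, 1 ≤ d → IsMonicRealRooted d (p d)
  law : IsLawWithMoments μ
  tendsto : ∀ n : ℕ, Tendsto (fun d : ℕ => mom (rootDistribution (p d)) n) atTop (𝓝 (mom μ n))

/-- The sequence `(p d)` for `d ≥ 1` has infinitesimal distribution `(μ, μ')`: it has limiting root
distribution `μ`, and its infinitesimal moments of all orders exist and are the values
`μ' (xⁿ)`. -/
structure HasInfinitesimalDistribution (p : ℕ → ℝ[X]) (μ : Measure ℝ) (μ' : ℝ[X] →ₗ[ℝ] ℝ) :
    Prop where
  limiting : HasLimitingDistribution p μ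
  tendsto : ∀ n : ℕ, Tendsto
    (fun d : ℕ => (d : ℝ) * (mom (rootDistribution (p d)) n - mom μ n)) atTop (𝓝 (μ' (X ^ n)))

/-! ### Non-crossing partitions and free cumulants -/

/-- A partition of `{0, …, n-1}` is non-crossing if `a < b < c < d` with `a, c` in a block `V` and
`b, d` in a block `W` forces `V = W`. -/
def IsNonCrossing {n : ℕ} (π : Finpartition (Finset.univ : Finset (Fin n))) : Prop :=
  ∀ a b c d : Fin n, a < b → b < c → c < d →
    ∀ V ∈ π.parts, ∀ W ∈ π.parts, a ∈ V → c ∈ V → b ∈ W → d ∈ W → V = W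

open Classical in
/-- The finite set of non-crossing partitions of an `n`-element ordered set. -/
noncomputable def NC (n : ℕ) : Finset (Finpartition (Finset.univ : Finset (Fin n))) :=
  Finset.univ.filter fun π => IsNonCrossing π

open Classical in
/-- The non-crossing partitions different from the one-block partition. -/
noncomputable def properNC (n : ℕ) : Finset (Finpartition (Finset.univ : Finset (Fin n))) :=
  (NC n).filter fun π => π.parts ≠ {Finset.univ}

theorem card_lt_of_mem_properNC {n : ℕ} {π : Finpartition (Finset.univ : Finset (Fin n))}
    (hπ : π ∈ properNC n) {V : Finset (Fin n)} (hV : V ∈ π.parts) : V.card < n := by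
  classical
  have hne : π.parts ≠ {Finset.univ} := (Finset.mem_filter.1 hπ).2
  have hle : V.card ≤ n := by simpa using Finset.card_le_univ V
  refine lt_of_le_of_ne hle fun h => hne ?_
  have hVu : V = Finset.univ := (Finset.card_eq_iff_eq_univ V).1 (by simpa using h)
  refine Finset.eq_singleton_iff_unique_mem.2 ⟨hVu ▸ hV, fun W hW => ?_⟩
  by_contra hWV
  have hdisj := π.disjoint hV hW (fun e => hWV (e ▸ hVu))
  rw [Function.onFun, id, id, hVu] at hdisj
  exact π.ne_bot hW (Finset.eq_empty_of_forall_notMem fun x hx =>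
    Finset.disjoint_left.1 hdisj (Finset.mem_univ x) hx)

/-- The free cumulants `rₙ` of a moment sequence `m`, defined recursively for `n ≥ 1` by
`mₙ = ∑_{π ∈ NC(n)} ∏_{V ∈ π} r_{|V|}`, see `moment_cumulant`. -/
noncomputable def freeCumulant (m : ℕ → ℝ) (n : ℕ) : ℝ :=
  m n - ∑ π ∈ (properNC n).attach, ∏ V ∈ π.1.parts.attach, freeCumulant m V.1.card
termination_by n
decreasing_by exact card_lt_of_mem_properNC π.2 V.2

open Classical in
/-- The infinitesimal free cumulants `r'ₙ` of a pair of moment sequences `(m, m')`, defined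
recursively for `n ≥ 1` by `m'ₙ = ∑_{π ∈ NC(n)} ∑_{V ∈ π} r'_{|V|} ∏_{W ∈ π, W ≠ V} r_{|W|}`, where
`r` are the free cumulants of `m`, see `inf_moment_cumulant`. -/
noncomputable def infFreeCumulant (m m' : ℕ → ℝ) (n : ℕ) : ℝ :=
  m' n - ∑ π ∈ (properNC n).attach, ∑ V ∈ π.1.parts.attach,
    infFreeCumulant m m' V.1.card * ∏ W ∈ π.1.parts.erase V.1, freeCumulant m W.card
termination_by n
decreasing_by exact card_lt_of_mem_properNC π.2 V.2

theorem sum_NC {n : ℕ} (hn : 1 ≤ n)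
    (F : Finset (Finset (Fin n)) → ℝ) :
    ∑ π ∈ NC n, F π.parts = F {Finset.univ} + ∑ π ∈ properNC n, F π.parts := by
  classical
  have hne : (Finset.univ : Finset (Fin n)) ≠ ⊥ := by
    have : Nonempty (Fin n) := ⟨⟨0, hn⟩⟩
    exact Finset.univ_nonempty.ne_empty
  set o : Finpartition (Finset.univ : Finset (Fin n)) := Finpartition.indiscrete hne with ho
  have hop : o.parts = {Finset.univ} := rfl
  have hoNC : o ∈ NC n := by
    refine Finset.mem_filter.2 ⟨Finset.mem_univ _, ?_⟩
    intro a b c d _ _ _ V hV W hW _ _ _ _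
    rw [hop, Finset.mem_singleton] at hV hW
    rw [hV, hW]
  have hprop : properNC n = (NC n).erase o := by
    ext π
    rw [properNC, Finset.mem_filter, Finset.mem_erase, and_comm]
    refine and_congr_left fun _ => not_congr ⟨fun h => Finpartition.ext (h.trans hop.symm),
      fun h => by rw [h, hop]⟩
  rw [hprop, ← Finset.add_sum_erase _ _ hoNC, hop]

/-- The free moment-cumulant formula. -/
theorem moment_cumulant (m : ℕ → ℝ) {n : ℕ} (hn : 1 ≤ n) :
    m n = ∑ π ∈ NC n, ∏ V ∈ π.parts, freeCumulant m V.card := by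
  classical
  rw [sum_NC hn (fun P => ∏ V ∈ P, freeCumulant m V.card), Finset.prod_singleton,
    Finset.card_univ, Fintype.card_fin]
  conv_rhs => rw [freeCumulant]
  rw [← Finset.sum_attach (properNC n)]
  simp only [Finset.prod_attach _ (fun V : Finset (Fin n) => freeCumulant m V.card)]
  ring

open Classical in
/-- The infinitesimal free moment-cumulant formula. -/
theorem inf_moment_cumulant (m m' : ℕ → ℝ) {n : ℕ} (hn : 1 ≤ n) :
    m' n = ∑ π ∈ NC n, ∑ V ∈ π.parts,
      infFreeCumulant m m' V.card * ∏ W ∈ π.parts.erase V, freeCumulant m W.card := by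
  rw [sum_NC hn (fun P => ∑ V ∈ P,
      infFreeCumulant m m' V.card * ∏ W ∈ P.erase V, freeCumulant m W.card), Finset.sum_singleton,
    Finset.card_univ, Fintype.card_fin]
  conv_rhs => rw [infFreeCumulant]
  rw [← Finset.sum_attach (properNC n)]
  have h : ∀ P : Finset (Finset (Fin n)), ∑ V ∈ P.attach, infFreeCumulant m m' V.1.card *
      ∏ W ∈ P.erase V.1, freeCumulant m W.card = ∑ V ∈ P, infFreeCumulant m m' V.card *
      ∏ W ∈ P.erase V, freeCumulant m W.card := fun P =>
    Finset.sum_attach P (fun V => infFreeCumulant m m' V.card *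
      ∏ W ∈ P.erase V, freeCumulant m W.card)
  simp only [h]
  simp

/-! ### Free and infinitesimal free additive convolution -/

/-- `γ` is a free additive convolution `μ ⊞ ν`: a probability measure with finite moments of all
orders whose free cumulants are the sums of those of `μ` and `ν`. -/
structure IsFreeAddConv (μ ν γ : Measure ℝ) : Prop where
  law : IsLawWithMoments γ
  cumulant_add : ∀ n : ℕ, 1 ≤ n →
    freeCumulant (mom γ) n = freeCumulant (mom μ) n + freeCumulant (mom ν) n

/-- The infinitesimal free cumulants of a pair of a measure and a linear functional on
polynomials. -/
noncomputable def infCumulant (μ : Measure ℝ) (μ' : ℝ[X] →ₗ[ℝ] ℝ) (n : ℕ) : ℝ :=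
  infFreeCumulant (mom μ) (fun k => μ' (X ^ k)) n

/-- `(γ, γ')` is the infinitesimal free additive convolution `(μ, μ') ⊞_B (ν, ν')`: `γ = μ ⊞ ν`,
`γ' 1 = 0`, and the infinitesimal free cumulants add up. -/
structure IsInfFreeAddConv (μ : Measure ℝ) (μ' : ℝ[X] →ₗ[ℝ] ℝ) (ν : Measure ℝ)
    (ν' : ℝ[X] →ₗ[ℝ] ℝ) (γ : Measure ℝ) (γ' : ℝ[X] →ₗ[ℝ] ℝ) : Prop where
  freeAddConv : IsFreeAddConv μ ν γ
  map_one : γ' 1 = 0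
  cumulant_add : ∀ n : ℕ, 1 ≤ n → infCumulant γ γ' n = infCumulant μ μ' n + infCumulant ν ν' n

end FiniteFree

/-!
The reversal of `p`, with roots `a`, is `∏ (1 - a z)`, and by Newton's identities its logarithmic
derivative is the negative of the power sum series `∑ₙ (∑ₐ aⁿ⁺¹) zⁿ`. So the infinitesimal
distribution of `p ⊞ q` is found from the difference of the logarithmic derivatives of the reversals
of `p_d ⊞_d q_d` and `p_d`.

Now `p_d ⊞_d q_d` arises from `p_d` by a differential operator whose coefficients come from the
reversal of `q_d`, which converges to a series `E` since `ν = δ₀`. After reversal the `k`-th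
derivative of `p_d`, divided by `dᵏ`, is asymptotically multiplication by `(z M)ᵏ`, with `M` the
moment series of `μ`. Thus the ratio of the reversals of `p_d ⊞_d q_d` and `p_d` tends to `E(z M)`,
whose logarithmic derivative is `-N(z M) (z M)'`, where `N` is the limit of the power sum series of
`q_d`. The functional equation `M = R(z M)` of the free cumulant series `R` identifies
`z N(z M) (z M)'` with the derivative of the moment series in the direction of the infinitesimal
cumulants `z N` of `(δ₀, ν')`.

Real-rootedness of `p_d ⊞_d q_d` follows from Grace's theorem on apolar polynomials.
-/

namespace FiniteFree

section NonCrossing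

variable {α β : Type*} [LinearOrder α] [LinearOrder β] {s t : Finset α}
  {P Q : Finset (Finset α)}

/-- `P` is the set of blocks of a non-crossing partition of `s`. Unlike in `Finpartition`, the set
`s` is not part of the type, so partitions of different sets can be united and restricted. -/
structure IsNCPart (s : Finset α) (P : Finset (Finset α)) : Prop where
  nonempty : ∀ V ∈ P, V.Nonempty
  subset : ∀ V ∈ P, V ⊆ s
  cover : ∀ x ∈ s, ∃ V ∈ P, x ∈ V
  unique : ∀ V ∈ P, ∀ W ∈ P, ∀ x ∈ V, x ∈ W → V = W
  nonCrossing : ∀ V ∈ P, ∀ W ∈ P, ∀ a ∈ V, ∀ b ∈ W, ∀ c ∈ V, ∀ d ∈ W,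
    a < b → b < c → c < d → V = W

open Classical in
/-- The finite set of non-crossing partitions of `s`, given by their sets of blocks. -/
noncomputable def ncParts (s : Finset α) : Finset (Finset (Finset α)) :=
  {P ∈ s.powerset.powerset | IsNCPart s P}

theorem mem_ncParts : P ∈ ncParts s ↔ IsNCPart s P := by
  classical
  simp only [ncParts, Finset.mem_filter, and_iff_right_iff_imp]
  exact fun h => Finset.mem_powerset.2 fun V hV => Finset.mem_powerset.2 (h.subset V hV)

theorem IsNCPart.mem_of_mem (h : IsNCPart s P) {V : Finset α} (hV : V ∈ P) {a : α} (ha : a ∈ V) :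
    a ∈ s :=
  h.subset V hV ha

theorem isNCPart_empty_iff : IsNCPart (∅ : Finset α) P ↔ P = ∅ := by
  constructor
  · intro h
    refine Finset.eq_empty_of_forall_notMem fun V hV => ?_
    exact (h.nonempty V hV).ne_empty (Finset.subset_empty.1 (h.subset V hV))
  · rintro rfl
    constructor <;> simp

theorem IsNCPart.filter_subset (h : IsNCPart s P) (ht : ∀ V ∈ P, V ⊆ t ∨ Disjoint V t) :
    IsNCPart (s ∩ t) {V ∈ P | V ⊆ t} := by
  have hcover : ∀ x ∈ s ∩ t, ∃ V ∈ ({V ∈ P | V ⊆ t} : Finset _), x ∈ V := by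
    intro x hx
    obtain ⟨hxs, hxt⟩ := Finset.mem_inter.1 hx
    obtain ⟨V, hV, hxV⟩ := h.cover x hxs
    have hVt := (ht V hV).resolve_right (Finset.not_disjoint_iff.2 ⟨x, hxV, hxt⟩)
    exact ⟨V, Finset.mem_filter.2 ⟨hV, hVt⟩, hxV⟩
  constructor <;> grind [IsNCPart]

theorem IsNCPart.union (hP : IsNCPart s P) (hQ : IsNCPart t Q) (hst : ∀ x ∈ s, ∀ y ∈ t, x < y) :
    IsNCPart (s ∪ t) (P ∪ Q) := by
  have separated : ∀ V ∈ P, ∀ W ∈ Q, ∀ a ∈ V, ∀ b ∈ W, a < b := fun V hV W hW a ha b hb =>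
    hst a (hP.mem_of_mem hV ha) b (hQ.mem_of_mem hW hb)
  refine ⟨by grind [hP.nonempty, hQ.nonempty], fun V hV => ?_,
    by grind [hP.cover, hQ.cover], by grind [hP.unique, hQ.unique], ?_⟩
  · rcases Finset.mem_union.1 hV with hV | hV
    · exact (hP.subset V hV).trans Finset.subset_union_left
    · exact (hQ.subset V hV).trans Finset.subset_union_right
  intro V hV W hW a ha b hb c hc d hd hab hbc hcd
  rcases Finset.mem_union.1 hV with hV | hV <;> rcases Finset.mem_union.1 hW with hW | hW
  · exact hP.nonCrossing V hV W hW a ha b hb c hc d hd hab hbc hcd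
  · exact absurd (separated V hV W hW c hc b hb) hbc.asymm
  · exact absurd (separated W hW V hV b hb a ha) hab.asymm
  · exact hQ.nonCrossing V hV W hW a ha b hb c hc d hd hab hbc hcd

theorem IsNCPart.disjoint (hP : IsNCPart s P) (hQ : IsNCPart t Q) (hst : Disjoint s t) :
    Disjoint P Q := by
  refine Finset.disjoint_left.2 fun V hVP hVQ => ?_
  obtain ⟨x, hx⟩ := hP.nonempty V hVP
  exact Finset.disjoint_left.1 hst (hP.mem_of_mem hVP hx) (hQ.mem_of_mem hVQ hx)

theorem isNCPart_map_iff (f : α ↪o β) :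
    IsNCPart (s.map f.toEmbedding) (P.map (Finset.mapEmbedding f.toEmbedding).toEmbedding) ↔
      IsNCPart s P := by
  refine ⟨fun h => ⟨?_, ?_, ?_, ?_, ?_⟩, fun h => ⟨?_, ?_, ?_, ?_, ?_⟩⟩
  · simpa using h.nonempty
  · simpa using h.subset
  · simpa using h.cover
  · intro V hV W hW x hxV hxW
    simpa using h.unique _ (Finset.mem_map_of_mem _ hV) _ (Finset.mem_map_of_mem _ hW) (f x)
      (Finset.mem_map_of_mem f.toEmbedding hxV) (Finset.mem_map_of_mem f.toEmbedding hxW)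
  · simpa using h.nonCrossing
  · simpa using h.nonempty
  · simpa using h.subset
  · simpa using h.cover
  · simp only [Finset.forall_mem_map, RelEmbedding.coe_toEmbedding, Finset.mapEmbedding_apply]
    intro V hV W hW x hxV hxW
    rw [h.unique V hV W hW x hxV (by simpa using hxW)]
  · simpa using h.nonCrossing

theorem ncParts_map (f : α ↪o β) (s : Finset α) :
    ncParts (s.map f.toEmbedding) = (ncParts s).map
      (Finset.mapEmbedding (Finset.mapEmbedding f.toEmbedding).toEmbedding).toEmbedding := by
  ext Q
  simp only [Finset.mem_map, mem_ncParts]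
  constructor
  · intro hQ
    obtain ⟨P, -, rfl⟩ : ∃ P ⊆ s.powerset,
        Q = P.map (Finset.mapEmbedding f.toEmbedding).toEmbedding := by
      refine Finset.subset_map_iff.1 fun W hW => ?_
      obtain ⟨V, hV, rfl⟩ := Finset.subset_map_iff.1 (hQ.subset W hW)
      exact Finset.mem_map_of_mem _ (Finset.mem_powerset.2 hV)
    exact ⟨P, (isNCPart_map_iff f).1 hQ, rfl⟩
  · rintro ⟨P, hP, rfl⟩
    exact (isNCPart_map_iff f).2 hP

theorem mem_NC_iff {n : ℕ} (π : Finpartition (Finset.univ : Finset (Fin n))) :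
    π ∈ NC n ↔ IsNCPart Finset.univ π.parts := by
  classical
  rw [NC, Finset.mem_filter, and_iff_right (Finset.mem_univ _)]
  constructor
  · intro h
    exact ⟨fun V hV => π.nonempty_of_mem_parts hV, fun V _ => Finset.subset_univ V,
      fun x hx => π.exists_mem hx, fun V hV W hW x hxV hxW => π.eq_of_mem_parts hV hW hxV hxW,
      fun V hV W hW a ha b hb c hc d hd hab hbc hcd =>
        h a b c d hab hbc hcd V hV W hW ha hc hb hd⟩
  · intro h a b c d hab hbc hcd V hV W hW ha hc hb hd
    exact h.nonCrossing V hV W hW a ha b hb c hc d hd hab hbc hcd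

theorem sum_NC_eq_sum_ncParts {M : Type*} [AddCommMonoid M] {n : ℕ}
    (F : Finset (Finset (Fin n)) → M) :
    ∑ π ∈ NC n, F π.parts = ∑ P ∈ ncParts (Finset.univ : Finset (Fin n)), F P := by
  classical
  refine Finset.sum_bij (fun π _ => π.parts) (fun π hπ => ?_) (fun π _ π' _ h => ?_)
    (fun P hP => ?_) (fun _ _ => rfl)
  · exact mem_ncParts.2 ((mem_NC_iff π).1 hπ)
  · exact Finpartition.ext h
  · have h := mem_ncParts.1 hP
    let π : Finpartition (Finset.univ : Finset (Fin n)) := Finpartition.ofExistsUnique P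
      (fun V _ => Finset.subset_univ V)
      (fun x hx => by
        obtain ⟨V, hV, hxV⟩ := h.cover x hx
        exact ⟨V, ⟨hV, hxV⟩, fun W hW => h.unique W hW.1 V hV x hW.2 hxV⟩)
      (fun hbot => by simpa using h.nonempty _ hbot)
    exact ⟨π, (mem_NC_iff π).2 h, rfl⟩

variable {R S : Type*} [CommSemiring R] [CommSemiring S]

/-- The sum over all non-crossing partitions of `s` of the product of the weights of the blocks,
where a block of size `k` has weight `r k`: the moments as a function of the free cumulants. -/
noncomputable def ncSum (r : ℕ → R) (s : Finset α) : R :=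
  ∑ P ∈ ncParts s, ∏ V ∈ P, r V.card

theorem map_ncSum (f : R →+* S) (r : ℕ → R) (s : Finset α) :
    f (ncSum r s) = ncSum (fun k => f (r k)) s := by
  simp only [ncSum, map_sum, map_prod]

theorem ncSum_empty (r : ℕ → R) : ncSum r (∅ : Finset α) = 1 := by
  have hparts : ncParts (∅ : Finset α) = {∅} := by
    ext P
    rw [mem_ncParts, isNCPart_empty_iff, Finset.mem_singleton]
  rw [ncSum, hparts, Finset.sum_singleton, Finset.prod_empty]

theorem ncSum_map (f : α ↪o β) (r : ℕ → R) (s : Finset α) :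
    ncSum r (s.map f.toEmbedding) = ncSum r s := by
  simp [ncSum, ncParts_map, Finset.sum_map, Finset.prod_map]

theorem ncSum_univ_fin (r : ℕ → R) (n : ℕ) :
    ncSum r (Finset.univ : Finset (Fin n)) = ncSum r (Finset.range n) := by
  rw [← ncSum_map (Fin.valOrderEmb n) r Finset.univ]
  congr 1
  ext x
  simp [Fin.exists_iff]

theorem ncSum_Ico (r : ℕ → R) (a n : ℕ) :
    ncSum r (Finset.Ico a (a + n)) = ncSum r (Finset.range n) := by
  rw [← ncSum_map (OrderEmbedding.addLeft a) r (Finset.range n), Finset.range_eq_Ico]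
  exact congrArg (ncSum r) (Finset.map_add_left_Ico 0 n a).symm

end NonCrossing

section MarkedPartition

variable {n : ℕ} {V : Finset ℕ} {P : Finset (Finset ℕ)}

/-- `V` is the block of `0` in a non-crossing partition of `{0, …, n-1}` and `P` is the set of the
other blocks. For `n = 0` this means `V = ∅` and `P = ∅`, the start of the recursion on `V`. -/
structure IsMarkedNCPart (n : ℕ) (V : Finset ℕ) (P : Finset (Finset ℕ)) : Prop where
  subset : V ⊆ Finset.range n
  zero_mem : 0 < n → 0 ∈ V
  isNCPart : IsNCPart (Finset.range n \ V) P
  separated : ∀ W ∈ P, ∀ v ∈ V, ∀ a ∈ W, ∀ b ∈ W, a < v → b < v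

open Classical in
/-- The pairs of the block of `0` and the set of the other blocks of the non-crossing partitions of
`{0, …, n-1}` in which the block of `0` has `k` elements. -/
noncomputable def markedNCParts (k n : ℕ) : Finset (Finset ℕ × Finset (Finset ℕ)) :=
  {p ∈ (Finset.range n).powerset ×ˢ (Finset.range n).powerset.powerset |
    p.1.card = k ∧ IsMarkedNCPart n p.1 p.2}

theorem mem_markedNCParts {k : ℕ} {p : Finset ℕ × Finset (Finset ℕ)} :
    p ∈ markedNCParts k n ↔ p.1.card = k ∧ IsMarkedNCPart n p.1 p.2 := by
  classical
  simp only [markedNCParts, Finset.mem_filter, Finset.mem_product, Finset.mem_powerset,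
    and_iff_right_iff_imp]
  rintro ⟨-, h⟩
  exact ⟨h.subset, fun W hW => Finset.mem_powerset.2
    ((h.isNCPart.subset W hW).trans Finset.sdiff_subset)⟩

theorem IsMarkedNCPart.notMem (h : IsMarkedNCPart n V P) (hn : 0 < n) : V ∉ P := fun hV =>
  (Finset.mem_sdiff.1 (h.isNCPart.mem_of_mem hV (h.zero_mem hn))).2 (h.zero_mem hn)

theorem IsMarkedNCPart.isNCPart_insert (h : IsMarkedNCPart n V P) (hn : 0 < n) :
    IsNCPart (Finset.range n) (insert V P) := by
  obtain ⟨hV, h0, hP, hsep⟩ := h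
  have hnotMem : ∀ W ∈ P, ∀ a ∈ W, a ∉ V := fun W hW a ha =>
    (Finset.mem_sdiff.1 (hP.mem_of_mem hW ha)).2
  refine ⟨?_, ?_, ?_, ?_, ?_⟩
  · exact (Finset.forall_mem_insert _ _ _).2 ⟨⟨0, h0 hn⟩, hP.nonempty⟩
  · exact (Finset.forall_mem_insert _ _ _).2
      ⟨hV, fun W hW => (hP.subset W hW).trans Finset.sdiff_subset⟩
  · intro x hx
    by_cases hxV : x ∈ V
    · exact ⟨V, Finset.mem_insert_self _ _, hxV⟩
    · obtain ⟨W, hW, hxW⟩ := hP.cover x (Finset.mem_sdiff.2 ⟨hx, hxV⟩)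
      exact ⟨W, Finset.mem_insert_of_mem hW, hxW⟩
  · intro W₁ hW₁ W₂ hW₂ x h₁ h₂
    rcases Finset.mem_insert.1 hW₁ with rfl | hW₁' <;>
      rcases Finset.mem_insert.1 hW₂ with rfl | hW₂'
    · rfl
    · exact absurd h₁ (hnotMem W₂ hW₂' x h₂)
    · exact absurd h₂ (hnotMem W₁ hW₁' x h₁)
    · exact hP.unique W₁ hW₁' W₂ hW₂' x h₁ h₂
  · intro W₁ hW₁ W₂ hW₂ a ha b hb c hc d hd hab hbc hcd
    rcases Finset.mem_insert.1 hW₁ with rfl | hW₁' <;>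
      rcases Finset.mem_insert.1 hW₂ with rfl | hW₂'
    · rfl
    · exact absurd (hsep W₂ hW₂' c hc b hb d hd hbc) hcd.not_gt
    · exact absurd (hsep W₁ hW₁' b hb a ha c hc hab) hbc.not_gt
    · exact hP.nonCrossing W₁ hW₁' W₂ hW₂' a ha b hb c hc d hd hab hbc hcd

theorem IsNCPart.isMarkedNCPart_erase (h : IsNCPart (Finset.range n) P) (hV : V ∈ P)
    (h0 : 0 ∈ V) : IsMarkedNCPart n V (P.erase V) := by
  refine ⟨h.subset V hV, fun _ => h0, ⟨?_, ?_, ?_, ?_, ?_⟩, ?_⟩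
  · grind [h.nonempty]
  · grind [h.mem_of_mem, h.unique]
  · grind [h.cover]
  · grind [h.unique]
  · exact fun W₁ hW₁ W₂ hW₂ => h.nonCrossing W₁ (Finset.mem_of_mem_erase hW₁) W₂
      (Finset.mem_of_mem_erase hW₂)
  · intro W hW v hv a ha b hb hav
    obtain ⟨hWV, hWP⟩ := Finset.mem_erase.1 hW
    have hmem_ne : ∀ w ∈ W, ∀ u ∈ V, w ≠ u := fun w hw u hu hwu =>
      hWV (h.unique W hWP V hV w hw (hwu ▸ hu))
    by_contra! hvb
    exact hWV (h.nonCrossing V hV W hWP 0 h0 a ha v hv b hb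
      (Nat.pos_of_ne_zero (hmem_ne a ha 0 h0)) hav (hvb.lt_of_ne (hmem_ne b hb v hv).symm)).symm

variable {R : Type*} [CommSemiring R]

theorem sum_ncParts_range_eq_sum_markedNCParts (hn : 0 < n) (w : Finset (Finset ℕ) → R) :
    ∑ P ∈ ncParts (Finset.range n), w P =
      ∑ k ∈ Finset.range (n + 1), ∑ p ∈ markedNCParts k n, w (insert p.1 p.2) := by
  classical
  rw [Finset.sum_sigma']
  symm
  refine Finset.sum_bij (fun p _ => insert p.2.1 p.2.2) ?_ ?_ ?_ (fun _ _ => rfl)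
  · rintro ⟨k, p⟩ hp
    simp only [Finset.mem_sigma, mem_markedNCParts] at hp
    exact mem_ncParts.2 (hp.2.2.isNCPart_insert hn)
  · rintro ⟨k₁, V₁, P₁⟩ h₁ ⟨k₂, V₂, P₂⟩ h₂ heq
    simp only [Finset.mem_sigma, mem_markedNCParts] at h₁ h₂ heq
    obtain ⟨-, rfl, h₁⟩ := h₁
    obtain ⟨-, rfl, h₂⟩ := h₂
    have hV : V₁ = V₂ := (h₂.isNCPart_insert hn).unique V₁ (heq ▸ Finset.mem_insert_self _ _) V₂
      (Finset.mem_insert_self _ _) 0 (h₁.zero_mem hn) (h₂.zero_mem hn)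
    subst hV
    have hP : P₁ = P₂ := by
      rw [← Finset.erase_insert (h₁.notMem hn), heq, Finset.erase_insert (h₂.notMem hn)]
    rw [hP]
  · intro P hP
    obtain ⟨V, hV, h0⟩ := (mem_ncParts.1 hP).cover 0 (Finset.mem_range.2 hn)
    have hmarked := (mem_ncParts.1 hP).isMarkedNCPart_erase hV h0
    have hcard : V.card < n + 1 := Nat.lt_succ_of_le (by
      simpa using Finset.card_le_card hmarked.subset)
    exact ⟨⟨V.card, V, P.erase V⟩, by simp [mem_markedNCParts, hmarked, hcard],
      Finset.insert_erase hV⟩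

/-- The sum over the non-crossing partitions of `{0, …, n-1}` in which the block of `0` has `k`
elements of the product of the weights of the other blocks, cf. `ncSum`. -/
noncomputable def markedSum (r : ℕ → R) (k n : ℕ) : R :=
  ∑ p ∈ markedNCParts k n, ∏ W ∈ p.2, r W.card

theorem ncSum_range_eq_sum_markedSum (r : ℕ → R) (hn : 0 < n) :
    ncSum r (Finset.range n) = ∑ k ∈ Finset.range (n + 1), r k * markedSum r k n := by
  classical
  rw [ncSum, sum_ncParts_range_eq_sum_markedNCParts hn]
  refine Finset.sum_congr rfl fun k _ => ?_
  rw [markedSum, Finset.mul_sum]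
  refine Finset.sum_congr rfl fun p hp => ?_
  obtain ⟨rfl, hmarked⟩ := mem_markedNCParts.1 hp
  rw [Finset.prod_insert (hmarked.notMem hn)]

theorem isMarkedNCPart_empty_iff : IsMarkedNCPart n ∅ P ↔ n = 0 ∧ P = ∅ := by
  constructor
  · intro h
    obtain rfl : n = 0 := Nat.eq_zero_of_not_pos fun hn => Finset.notMem_empty 0 (h.zero_mem hn)
    exact ⟨rfl, isNCPart_empty_iff.1 (by simpa using h.isNCPart)⟩
  · rintro ⟨rfl, rfl⟩
    exact ⟨by simp, by simp, by simp [isNCPart_empty_iff], by simp⟩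

theorem markedSum_zero (r : ℕ → R) (n : ℕ) : markedSum r 0 n = if n = 0 then 1 else 0 := by
  have hmem : ∀ p, p ∈ markedNCParts 0 n ↔ n = 0 ∧ p = (∅, ∅) := by
    rintro ⟨V, P⟩
    rw [mem_markedNCParts, Finset.card_eq_zero, Prod.mk.injEq]
    constructor
    · rintro ⟨rfl, h⟩
      exact ⟨(isMarkedNCPart_empty_iff.1 h).1, rfl, (isMarkedNCPart_empty_iff.1 h).2⟩
    · rintro ⟨hn, rfl, rfl⟩
      exact ⟨rfl, isMarkedNCPart_empty_iff.2 ⟨hn, rfl⟩⟩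
  split_ifs with hn
  · have hparts : markedNCParts 0 n = {(∅, ∅)} := by
      ext p
      rw [hmem, and_iff_right hn, Finset.mem_singleton]
    simp [markedSum, hparts]
  · have hparts : markedNCParts 0 n = ∅ := by
      ext p
      simp [hmem, hn]
    simp [markedSum, hparts]

section Peel

variable {x : ℕ} {Q : Finset (Finset ℕ)}

theorem IsMarkedNCPart.peel_left (h : IsMarkedNCPart n V P) (hx : x ∈ V) (hmax : ∀ v ∈ V, v ≤ x) :
    IsMarkedNCPart x (V.erase x) {W ∈ P | W ⊆ Finset.range x} := by
  have hxn := Finset.mem_range.1 (h.subset hx)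
  have hdichotomy : ∀ W ∈ P, W ⊆ Finset.range x ∨ Disjoint W (Finset.range x) := by
    intro W hW
    by_contra! hcross
    obtain ⟨a, haW, hax⟩ := Finset.not_disjoint_iff.1 hcross.2
    exact hcross.1 fun b hb => Finset.mem_range.2
      (h.separated W hW x hx a haW b hb (Finset.mem_range.1 hax))
  refine ⟨?_, ?_, ?_, ?_⟩
  · intro v hv
    obtain ⟨hvx, hvV⟩ := Finset.mem_erase.1 hv
    exact Finset.mem_range.2 ((hmax v hvV).lt_of_ne hvx)
  · exact fun hx0 => Finset.mem_erase.2 ⟨hx0.ne, h.zero_mem (hx0.trans hxn)⟩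
  · convert h.isNCPart.filter_subset hdichotomy using 1
    grind
  · exact fun W hW v hv => h.separated W (Finset.mem_of_mem_filter W hW) v
      (Finset.mem_of_mem_erase hv)

theorem IsMarkedNCPart.peel_right (h : IsMarkedNCPart n V P) (hx : x ∈ V)
    (hmax : ∀ v ∈ V, v ≤ x) :
    IsNCPart (Finset.Ico (x + 1) n) {W ∈ P | W ⊆ Finset.Ico (x + 1) n} := by
  have hdichotomy : ∀ W ∈ P, W ⊆ Finset.Ico (x + 1) n ∨ Disjoint W (Finset.Ico (x + 1) n) := by
    intro W hW
    by_contra! hcross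
    obtain ⟨b, hbW, hbx⟩ := Finset.not_disjoint_iff.1 hcross.2
    obtain ⟨a, haW, hax⟩ := Finset.not_subset.1 hcross.1
    have haV := Finset.mem_sdiff.1 (h.isNCPart.mem_of_mem hW haW)
    have hlt : a < x := by grind
    have := h.separated W hW x hx a haW b hbW hlt
    grind
  convert h.isNCPart.filter_subset hdichotomy using 1
  grind

theorem IsMarkedNCPart.peel_union (h : IsMarkedNCPart n V P) (hx : x ∈ V) :
    ({W ∈ P | W ⊆ Finset.range x} ∪ {W ∈ P | W ⊆ Finset.Ico (x + 1) n} : Finset _) = P := by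
  rw [← Finset.filter_or, Finset.filter_eq_self]
  intro W hW
  have hWV := fun a (ha : a ∈ W) => Finset.mem_sdiff.1 (h.isNCPart.mem_of_mem hW ha)
  by_contra! hcross
  obtain ⟨b, hbW, hbx⟩ := Finset.not_subset.1 hcross.1
  obtain ⟨a, haW, hax⟩ := Finset.not_subset.1 hcross.2
  have hlt : a < x := by grind
  have := h.separated W hW x hx a haW b hbW hlt
  grind

theorem IsMarkedNCPart.glue (h : IsMarkedNCPart x V P) (hQ : IsNCPart (Finset.Ico (x + 1) n) Q)
    (hxn : x < n) : IsMarkedNCPart n (insert x V) (P ∪ Q) := by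
  obtain ⟨hV, h0, hP, hsep⟩ := h
  refine ⟨by grind, fun _ => ?_, ?_, ?_⟩
  · rcases x.eq_zero_or_pos with rfl | hx
    · exact Finset.mem_insert_self _ _
    · exact Finset.mem_insert_of_mem (h0 hx)
  · convert hP.union hQ (by grind) using 1
    grind
  · intro W hW v hv a ha b hb hav
    rcases Finset.mem_union.1 hW with hW | hW <;> rcases Finset.mem_insert.1 hv with rfl | hv
    · grind [hP.mem_of_mem hW hb]
    · exact hsep W hW v hv a ha b hb hav
    · grind [hQ.mem_of_mem hW ha]
    · grind [hQ.mem_of_mem hW ha]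

theorem IsMarkedNCPart.filter_glue_left (h : IsMarkedNCPart x V P)
    (hQ : IsNCPart (Finset.Ico (x + 1) n) Q) :
    {W ∈ P ∪ Q | W ⊆ Finset.range x} = P := by
  have hP : ∀ W ∈ P, W ⊆ Finset.range x := fun W hW =>
    (h.isNCPart.subset W hW).trans Finset.sdiff_subset
  have hQx : ∀ W ∈ Q, ¬ W ⊆ Finset.range x := by
    intro W hW hWx
    obtain ⟨a, ha⟩ := hQ.nonempty W hW
    grind [hQ.mem_of_mem hW ha]
  rw [Finset.filter_union, Finset.filter_true_of_mem hP, Finset.filter_false_of_mem hQx,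
    Finset.union_empty]

theorem IsMarkedNCPart.filter_glue_right (h : IsMarkedNCPart x V P)
    (hQ : IsNCPart (Finset.Ico (x + 1) n) Q) :
    {W ∈ P ∪ Q | W ⊆ Finset.Ico (x + 1) n} = Q := by
  have hPx : ∀ W ∈ P, ¬ W ⊆ Finset.Ico (x + 1) n := by
    intro W hW hWx
    obtain ⟨a, ha⟩ := h.isNCPart.nonempty W hW
    grind [h.isNCPart.mem_of_mem hW ha]
  rw [Finset.filter_union, Finset.filter_false_of_mem hPx, Finset.filter_true_of_mem hQ.subset,
    Finset.empty_union]

theorem IsMarkedNCPart.notMem_self (h : IsMarkedNCPart x V P) : x ∉ V := fun hx =>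
  Finset.notMem_range_self (h.subset hx)

theorem IsMarkedNCPart.sup_insert (h : IsMarkedNCPart x V P) : (insert x V).sup id = x :=
  le_antisymm (Finset.sup_le (by grind [h.subset])) (Finset.le_sup (f := id) (by grind))

theorem IsMarkedNCPart.disjoint_glue (h : IsMarkedNCPart x V P)
    (hQ : IsNCPart (Finset.Ico (x + 1) n) Q) : Disjoint P Q :=
  h.isNCPart.disjoint hQ (Finset.disjoint_left.2 (by grind))

end Peel

theorem sup_id_mem_of_card_eq_succ {k : ℕ} (hV : V.card = k + 1) : V.sup id ∈ V := by
  have hne : V.Nonempty := Finset.card_pos.1 (by omega)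
  obtain ⟨v, hv, hsup⟩ := Finset.exists_mem_eq_sup V hne id
  exact hsup ▸ hv

theorem le_sup_id : ∀ v ∈ V, v ≤ V.sup id := fun _ hv => Finset.le_sup (f := id) hv

theorem sum_markedNCParts_succ {M : Type*} [AddCommMonoid M] (w : Finset (Finset ℕ) → M)
    (k n : ℕ) : ∑ p ∈ markedNCParts (k + 1) n, w p.2 =
      ∑ x ∈ Finset.range n, ∑ p ∈ markedNCParts k x, ∑ Q ∈ ncParts (Finset.Ico (x + 1) n),
        w (p.2 ∪ Q) := by
  classical
  simp only [← Finset.sum_product']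
  rw [Finset.sum_sigma']
  refine Finset.sum_bij'
    (fun p _ => ⟨p.1.sup id, (p.1.erase (p.1.sup id), {W ∈ p.2 | W ⊆ Finset.range (p.1.sup id)}),
      {W ∈ p.2 | W ⊆ Finset.Ico (p.1.sup id + 1) n}⟩)
    (fun p _ => (insert p.1 p.2.1.1, p.2.1.2 ∪ p.2.2)) ?_ ?_ ?_ ?_ ?_
  · rintro ⟨V, P⟩ hp
    obtain ⟨hcard, h⟩ := mem_markedNCParts.1 hp
    have hmem := sup_id_mem_of_card_eq_succ hcard
    refine Finset.mem_sigma.2 ⟨h.subset hmem, Finset.mem_product.2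
      ⟨mem_markedNCParts.2 ⟨?_, h.peel_left hmem le_sup_id⟩,
        mem_ncParts.2 (h.peel_right hmem le_sup_id)⟩⟩
    rw [Finset.card_erase_of_mem hmem, hcard, Nat.add_sub_cancel]
  · rintro ⟨x, ⟨V, P⟩, Q⟩ hp
    simp only [Finset.mem_sigma, Finset.mem_product, mem_markedNCParts, mem_ncParts] at hp
    obtain ⟨hx, ⟨hcard, h⟩, hQ⟩ := hp
    refine mem_markedNCParts.2 ⟨?_, h.glue hQ (Finset.mem_range.1 hx)⟩
    rw [Finset.card_insert_of_notMem h.notMem_self, hcard]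
  · rintro ⟨V, P⟩ hp
    obtain ⟨hcard, h⟩ := mem_markedNCParts.1 hp
    have hmem := sup_id_mem_of_card_eq_succ hcard
    exact Prod.ext (Finset.insert_erase hmem) (h.peel_union hmem)
  · rintro ⟨x, ⟨V, P⟩, Q⟩ hp
    simp only [Finset.mem_sigma, Finset.mem_product, mem_markedNCParts, mem_ncParts] at hp
    obtain ⟨-, ⟨-, h⟩, hQ⟩ := hp
    simp only [h.sup_insert, Finset.erase_insert h.notMem_self, h.filter_glue_left hQ,
      h.filter_glue_right hQ]
  · rintro ⟨V, P⟩ hp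
    obtain ⟨hcard, h⟩ := mem_markedNCParts.1 hp
    exact congrArg w (h.peel_union (sup_id_mem_of_card_eq_succ hcard)).symm

theorem markedSum_succ (r : ℕ → R) (k n : ℕ) :
    markedSum r (k + 1) n =
      ∑ x ∈ Finset.range n, markedSum r k x * ncSum r (Finset.range (n - 1 - x)) := by
  simp only [markedSum]
  rw [sum_markedNCParts_succ (fun P => ∏ W ∈ P, r W.card)]
  refine Finset.sum_congr rfl fun x hx => ?_
  have hIco : Finset.Ico (x + 1) n = Finset.Ico (x + 1) (x + 1 + (n - 1 - x)) := by
    grind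
  rw [← ncSum_Ico r (x + 1), ← hIco, ncSum, Finset.sum_mul_sum]
  refine Finset.sum_congr rfl fun p hp => Finset.sum_congr rfl fun Q hQ => ?_
  exact Finset.prod_union
    ((mem_markedNCParts.1 hp).2.disjoint_glue (mem_ncParts.1 hQ))

end MarkedPartition

section Substitution

variable {R A : Type*} [CommRing R] [CommRing A] [Algebra R A]

theorem coeff_pow_mul_eq_zero {w : PowerSeries A} (hw : PowerSeries.constantCoeff w = 0)
    (v : PowerSeries A) {n k : ℕ} (hnk : n < k) : PowerSeries.coeff n (w ^ k * v) = 0 := by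
  obtain ⟨u, rfl⟩ := PowerSeries.X_dvd_iff.2 hw
  rw [mul_pow, mul_assoc, PowerSeries.coeff_X_pow_mul', if_neg (not_le.2 hnk)]

theorem coeff_subst_eq_sum {w : PowerSeries A} (hw : PowerSeries.constantCoeff w = 0)
    (F : PowerSeries A) {n N : ℕ} (hnN : n < N) : PowerSeries.coeff n (F.subst w) =
      ∑ k ∈ Finset.range N, PowerSeries.coeff k F * PowerSeries.coeff n (w ^ k) := by
  rw [PowerSeries.coeff_subst' (.of_constantCoeff_zero' hw)]
  refine finsum_eq_sum_of_support_subset _ fun k hk => ?_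
  rw [Finset.coe_range, Set.mem_Iio]
  by_contra hNk
  have hzero := coeff_pow_mul_eq_zero hw 1 (hnN.trans_le (not_lt.1 hNk))
  rw [mul_one] at hzero
  exact hk ((congrArg _ hzero).trans (smul_zero _))

theorem coeff_subst_mul_eq_sum {w : PowerSeries A} (hw : PowerSeries.constantCoeff w = 0)
    (F v : PowerSeries A) {n N : ℕ} (hnN : n < N) : PowerSeries.coeff n (F.subst w * v) =
      ∑ k ∈ Finset.range N, PowerSeries.coeff k F * PowerSeries.coeff n (w ^ k * v) := by
  simp only [PowerSeries.coeff_mul, Finset.mul_sum]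
  rw [Finset.sum_comm]
  refine Finset.sum_congr rfl fun x hx => ?_
  have hxn : x.1 ≤ n := Finset.HasAntidiagonal.mem_antidiagonal.1 hx ▸ Nat.le_add_right _ _
  rw [coeff_subst_eq_sum hw F (hxn.trans_lt hnN), Finset.sum_mul]
  exact Finset.sum_congr rfl fun k _ => mul_assoc _ _ _

/-- The derivation of `A⟦z⟧` that applies a derivation of the coefficient ring to each
coefficient, as opposed to the derivative with respect to `z`. -/
noncomputable def coeffDerivation (D : Derivation R A A) :
    Derivation R (PowerSeries A) (PowerSeries A) :=
  Derivation.mk'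
    { toFun := fun F => PowerSeries.mk fun n => D (PowerSeries.coeff n F)
      map_add' := fun F G => by ext n; simp
      map_smul' := fun c F => by ext n; simp }
    fun F G => by
      ext n
      simp only [LinearMap.coe_mk, AddHom.coe_mk, smul_eq_mul, map_add, PowerSeries.coeff_mk,
        PowerSeries.coeff_mul, map_sum, Derivation.leibniz, Finset.sum_add_distrib]
      rw [← Finset.Nat.sum_antidiagonal_swap (f := fun x : ℕ × ℕ =>
        PowerSeries.coeff x.1 G * D (PowerSeries.coeff x.2 F))]
      rfl

theorem coeff_coeffDerivation (D : Derivation R A A) (F : PowerSeries A) (n : ℕ) :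
    PowerSeries.coeff n (coeffDerivation D F) = D (PowerSeries.coeff n F) := by
  simp [coeffDerivation]

theorem coeffDerivation_subst (D : Derivation R A A) {w : PowerSeries A}
    (hw : PowerSeries.constantCoeff w = 0) (F : PowerSeries A) :
    coeffDerivation D (F.subst w) = (coeffDerivation D F).subst w +
      (PowerSeries.derivative A F).subst w * coeffDerivation D w := by
  ext n
  have hpow : ∀ k : ℕ, D (PowerSeries.coeff n (w ^ (k + 1))) =
      (k + 1) * PowerSeries.coeff n (w ^ k * coeffDerivation D w) := fun k => by
    rw [← coeff_coeffDerivation, Derivation.leibniz_pow, Nat.add_sub_cancel, map_nsmul,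
      nsmul_eq_mul, smul_eq_mul, Nat.cast_succ]
  rw [map_add, coeff_coeffDerivation, coeff_subst_eq_sum hw F (Nat.lt_succ_of_lt n.lt_succ_self),
    coeff_subst_eq_sum hw _ (Nat.lt_succ_of_lt n.lt_succ_self),
    coeff_subst_mul_eq_sum hw _ _ n.lt_succ_self]
  simp only [map_sum, Derivation.leibniz, smul_eq_mul, coeff_coeffDerivation,
    Finset.sum_add_distrib, PowerSeries.coeff_derivative]
  rw [add_comm]
  congr 1
  · exact Finset.sum_congr rfl fun k _ => mul_comm _ _
  · rw [Finset.sum_range_succ', pow_zero, ← coeff_coeffDerivation, Derivation.map_one_eq_zero,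
      map_zero, mul_zero, add_zero]
    exact Finset.sum_congr rfl fun k _ => by rw [hpow, mul_assoc]

end Substitution

section MomentSeries

variable {R : Type*}

/-- The generating function of the moments with free cumulants `r`. -/
noncomputable def ncSeries [CommSemiring R] (r : ℕ → R) : PowerSeries R :=
  PowerSeries.mk fun n => ncSum r (Finset.range n)

theorem coeff_ncSeries [CommSemiring R] (r : ℕ → R) (n : ℕ) :
    PowerSeries.coeff n (ncSeries r) = ncSum r (Finset.range n) :=
  PowerSeries.coeff_mk _ _

theorem constantCoeff_ncSeries [CommSemiring R] (r : ℕ → R) :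
    PowerSeries.constantCoeff (ncSeries r) = 1 := by
  rw [← PowerSeries.coeff_zero_eq_constantCoeff_apply, coeff_ncSeries, Finset.range_zero,
    ncSum_empty]

theorem coeff_X_mul_ncSeries_pow [CommSemiring R] (r : ℕ → R) (k n : ℕ) :
    PowerSeries.coeff n ((PowerSeries.X * ncSeries r) ^ k) = markedSum r k n := by
  induction k generalizing n with
  | zero => rw [pow_zero, PowerSeries.coeff_one, markedSum_zero]
  | succ k ih =>
    rw [markedSum_succ, pow_succ, mul_left_comm]
    cases n with
    | zero => simp
    | succ n =>
      rw [PowerSeries.coeff_succ_X_mul, PowerSeries.coeff_mul,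
        Finset.Nat.sum_antidiagonal_eq_sum_range_succ_mk]
      exact Finset.sum_congr rfl fun x _ => by rw [ih, coeff_ncSeries, Nat.add_sub_cancel]

theorem ncSeries_eq_subst [CommRing R] {r : ℕ → R} (hr : r 0 = 1) :
    ncSeries r = (PowerSeries.mk r).subst (PowerSeries.X * ncSeries r) := by
  have hw : PowerSeries.constantCoeff (PowerSeries.X * ncSeries r) = 0 := by simp
  ext n
  rw [coeff_subst_eq_sum hw _ n.lt_succ_self]
  simp only [PowerSeries.coeff_mk, coeff_X_mul_ncSeries_pow, coeff_ncSeries]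
  rcases n.eq_zero_or_pos with rfl | hn
  · simp [ncSum_empty, markedSum_zero, hr]
  · exact ncSum_range_eq_sum_markedSum r hn

/-- Differentiating `M = F(zM)` in both ways, by `z` and on the coefficients, eliminates `F'`. -/
theorem coeffDerivation_mul_of_eq_subst {A : Type*} [CommRing R] [CommRing A] [Algebra R A]
    (D : Derivation R A A) {F M : PowerSeries A} (hM : M = F.subst (PowerSeries.X * M)) :
    coeffDerivation D M * M = (coeffDerivation D F).subst (PowerSeries.X * M) *
      PowerSeries.derivative A (PowerSeries.X * M) := by
  have hw : PowerSeries.constantCoeff (PowerSeries.X * M) = 0 := by simp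
  have hX : coeffDerivation D PowerSeries.X = 0 := by
    ext n
    rw [coeff_coeffDerivation, PowerSeries.coeff_X]
    split_ifs <;> simp
  have hDw : coeffDerivation D (PowerSeries.X * M) = PowerSeries.X * coeffDerivation D M := by
    simp [Derivation.leibniz, hX]
  have hcoeff := congrArg (coeffDerivation D) hM
  have hz := congrArg (PowerSeries.derivative A) hM
  rw [coeffDerivation_subst D hw, hDw] at hcoeff
  rw [PowerSeries.derivative_subst (.of_constantCoeff_zero' hw)] at hz
  have hw' : PowerSeries.derivative A (PowerSeries.X * M) =
      M + PowerSeries.X * PowerSeries.derivative A M := by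
    simp [Derivation.leibniz, add_comm]
  rw [hz] at hw'
  linear_combination PowerSeries.derivative A (PowerSeries.X * M) * hcoeff -
    coeffDerivation D M * hw'

end MomentSeries

section MomentDerivative

variable {R α β : Type*} [LinearOrder α] [LinearOrder β]

open Classical in
/-- The derivative of `ncSum` at the weights `r` in the direction `f`: the infinitesimal moments
as a function of the free and infinitesimal free cumulants. -/
noncomputable def ncDeriv [CommSemiring R] (r f : ℕ → R) (s : Finset α) : R :=
  ∑ P ∈ ncParts s, ∑ V ∈ P, f V.card * ∏ W ∈ P.erase V, r W.card

theorem ncDeriv_add [CommSemiring R] (r f g : ℕ → R) (s : Finset α) :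
    ncDeriv r (f + g) s = ncDeriv r f s + ncDeriv r g s := by
  simp only [ncDeriv, Pi.add_apply, add_mul, Finset.sum_add_distrib]

theorem eval_zero_derivative_ncSum [CommSemiring R] (r f : ℕ → R) (s : Finset α) :
    (derivative (ncSum (fun k => C (r k) + X * C (f k)) s)).eval 0 = ncDeriv r f s := by
  classical
  simp [ncSum, ncDeriv, derivative_prod_finset, eval_finsetSum, eval_prod,
    mul_comm (∏ _ ∈ _, _)]

theorem ncDeriv_univ_fin [CommSemiring R] (r f : ℕ → R) (n : ℕ) :
    ncDeriv r f (Finset.univ : Finset (Fin n)) = ncDeriv r f (Finset.range n) := by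
  rw [← eval_zero_derivative_ncSum, ncSum_univ_fin, eval_zero_derivative_ncSum]

/-- The generating function of the infinitesimal moments with free cumulants `r` and infinitesimal
free cumulants `f`. -/
noncomputable def ncDerivSeries [CommSemiring R] (r f : ℕ → R) : PowerSeries R :=
  PowerSeries.mk fun n => ncDeriv r f (Finset.range n)

theorem coeff_ncDerivSeries [CommSemiring R] (r f : ℕ → R) (n : ℕ) :
    PowerSeries.coeff n (ncDerivSeries r f) = ncDeriv r f (Finset.range n) :=
  PowerSeries.coeff_mk _ _

theorem ncDerivSeries_mul_ncSeries [CommRing R] {r f : ℕ → R} (hr : r 0 = 1) (hf : f 0 = 0) :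
    ncDerivSeries r f * ncSeries r = (PowerSeries.mk f).subst (PowerSeries.X * ncSeries r) *
      PowerSeries.derivative R (PowerSeries.X * ncSeries r) := by
  let w : ℕ → R[X] := fun k => C (r k) + X * C (f k)
  let D : Derivation R R[X] R[X] := derivative'
  let atZero : PowerSeries R[X] →+* PowerSeries R := PowerSeries.map (evalRingHom 0)
  have hwone : w 0 = 1 := by simp [w, hr, hf]
  have hM : atZero (ncSeries w) = ncSeries r := by
    ext n
    rw [PowerSeries.coeff_map, coeff_ncSeries, map_ncSum, coeff_ncSeries]
    simp [w]
  have hXM : atZero (PowerSeries.X * ncSeries w) = PowerSeries.X * ncSeries r := by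
    rw [map_mul, PowerSeries.map_X, hM]
  have hDM : atZero (coeffDerivation D (ncSeries w)) = ncDerivSeries r f := by
    ext n
    rw [PowerSeries.coeff_map, coeff_coeffDerivation, coeff_ncSeries, coeff_ncDerivSeries]
    exact eval_zero_derivative_ncSum r f _
  have hDw : atZero (coeffDerivation D (PowerSeries.mk w)) = PowerSeries.mk f := by
    ext n
    simp [atZero, coeff_coeffDerivation, D, w]
  have hz : ∀ F, atZero (PowerSeries.derivative R[X] F) =
      PowerSeries.derivative R (atZero F) := fun F => by
    ext n
    simp [atZero, PowerSeries.coeff_derivative]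
  have h := congrArg atZero (coeffDerivation_mul_of_eq_subst D (ncSeries_eq_subst hwone))
  have hsubst : atZero ((coeffDerivation D (PowerSeries.mk w)).subst
      (PowerSeries.X * ncSeries w)) = (PowerSeries.mk f).subst (PowerSeries.X * ncSeries r) := by
    rw [← hDw, ← hXM]
    exact PowerSeries.map_subst (.of_constantCoeff_zero' (by simp)) _
  rwa [map_mul, map_mul, hz, hM, hDM, hsubst, hXM] at h

end MomentDerivative

section FiniteFreeConvolution

variable {d : ℕ} {p q : ℝ[X]}

theorem coeff_addConv {k : ℕ} (hk : k ≤ d) (p q : ℝ[X]) :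
    (addConv d p q).coeff (d - k) = (-1) ^ k * (d.choose k : ℝ) *
      ∑ i ∈ Finset.range (k + 1), (k.choose i : ℝ) * normCoeff d p i * normCoeff d q (k - i) := by
  rw [addConv, finsetSum_coeff, Finset.sum_eq_single_of_mem k (Finset.mem_range_succ_iff.2 hk)]
  · rw [coeff_C_mul_X_pow, if_pos rfl]
  · intro j hj hjk
    have := Finset.mem_range.1 hj
    rw [coeff_C_mul_X_pow, if_neg (by omega)]

theorem natDegree_addConv_le (d : ℕ) (p q : ℝ[X]) : (addConv d p q).natDegree ≤ d := by
  refine natDegree_sum_le_of_forall_le _ _ fun k _ => ?_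
  exact (natDegree_C_mul_X_pow_le _ _).trans (Nat.sub_le _ _)

theorem coeff_addConv_self (d : ℕ) (p q : ℝ[X]) :
    (addConv d p q).coeff d = p.coeff d * q.coeff d := by
  simpa [normCoeff] using coeff_addConv d.zero_le p q

theorem choose_mul_normCoeff_mul_normCoeff {i j : ℕ} (hij : i + j ≤ d) (p q : ℝ[X]) :
    (-1) ^ (i + j) * (d.choose (i + j) : ℝ) *
        (((i + j).choose i : ℝ) * normCoeff d p i * normCoeff d q j) =
      q.coeff (d - j) / d.choose j * ((d - i).choose j * p.coeff (d - i)) := by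
  have hi : (d.choose i : ℝ) ≠ 0 := by
    exact_mod_cast (Nat.choose_pos (le_of_add_le_left hij)).ne'
  have hchoose : (d.choose (i + j) : ℝ) * (i + j).choose i = d.choose i * (d - i).choose j := by
    have h := Nat.choose_mul (n := d) (Nat.le_add_right i j)
    rw [Nat.add_sub_cancel_left] at h
    exact_mod_cast h
  have hsign : ∀ k : ℕ, ((-1 : ℝ) ^ k) * (-1) ^ k = 1 := fun k => by rw [← mul_pow]; simp
  calc _ = (d.choose (i + j) * (i + j).choose i) * ((-1) ^ i * (-1) ^ i) * ((-1) ^ j * (-1) ^ j) *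
        (p.coeff (d - i) / d.choose i) * (q.coeff (d - j) / d.choose j) := by
        rw [normCoeff, normCoeff]; ring
    _ = _ := by rw [hchoose, hsign, hsign]; field_simp

theorem addConv_eq_sum_hasseDeriv (q : ℝ[X]) (hp : p.natDegree ≤ d) :
    addConv d p q = ∑ k ∈ Finset.range (d + 1),
      C (q.coeff (d - k) / (d.choose k : ℝ)) * hasseDeriv k p := by
  have hvanish : ∀ {j k : ℕ}, d < j + k →
      (C (q.coeff (d - k) / (d.choose k : ℝ)) * hasseDeriv k p).coeff j = 0 := fun {j k} hjk => by
    rw [coeff_C_mul, hasseDeriv_coeff, coeff_eq_zero_of_natDegree_lt (hp.trans_lt hjk), mul_zero,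
      mul_zero]
  ext j
  rw [finsetSum_coeff]
  rcases lt_or_ge d j with hj | hj
  · rw [coeff_eq_zero_of_natDegree_lt ((natDegree_addConv_le d p q).trans_lt hj),
      Finset.sum_eq_zero fun k _ => hvanish (hj.trans_le (Nat.le_add_right j k))]
  · obtain ⟨m, hm, rfl⟩ : ∃ m ≤ d, j = d - m := ⟨d - j, by omega, by omega⟩
    have htrunc := Finset.sum_subset (Finset.range_mono (Nat.succ_le_succ hm)) fun k _ hk =>
      hvanish (j := d - m) (k := k) (by rw [Finset.mem_range] at hk; omega)
    rw [coeff_addConv hm, ← htrunc, Finset.mul_sum, ← Finset.sum_range_reflect]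
    refine Finset.sum_congr rfl fun k hk => ?_
    have hkm : k ≤ m := Finset.mem_range_succ_iff.1 hk
    have hterm := choose_mul_normCoeff_mul_normCoeff (i := m - k) (j := k) (d := d) (by omega) p q
    rw [Nat.sub_add_cancel hkm, show d - (m - k) = d - m + k by omega] at hterm
    rw [Nat.add_sub_cancel, Nat.sub_sub_self hkm, hterm, coeff_C_mul, hasseDeriv_coeff]

end FiniteFreeConvolution

section Grace

/-- The polar derivative with respect to the point `α` of a polynomial `f` of degree `n`. -/
noncomputable def polarDerivative {K : Type*} [CommRing K] (n : ℕ) (α : K) (f : K[X]) : K[X] :=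
  (n : K[X]) * f - (X - C α) * derivative f

/-- The bilinear pairing of polynomials of degree `d` whose vanishing is apolarity, up to the sign
change `X ↦ -X` in one argument. -/
noncomputable def apolarPairing {K : Type*} [Field K] (d : ℕ) (q f : K[X]) : K :=
  ∑ k ∈ Finset.range (d + 1), q.coeff (d - k) * f.coeff k / d.choose k

theorem coeff_polarDerivative {K : Type*} [CommRing K] (n : ℕ) (α : K) (f : K[X]) (k : ℕ) :
    (polarDerivative n α f).coeff k =
      (n - k) * f.coeff k + α * ((k + 1) * f.coeff (k + 1)) := by
  have hn : (n : K[X]) = C (n : K) := by simp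
  rw [polarDerivative, hn, coeff_sub, sub_mul, coeff_sub, coeff_C_mul, coeff_C_mul,
    coeff_derivative]
  rcases k with _ | k
  · simp
  · rw [coeff_X_mul, coeff_derivative]
    push_cast
    ring

theorem succ_div_choose_eq {K : Type*} [Field K] [CharZero K] {d k : ℕ} (hkd : k ≤ d) :
    ((d : K) + 1) / (d + 1).choose k = (d + 1 - k) / d.choose k := by
  have hd : (d.choose k : K) ≠ 0 := by exact_mod_cast (Nat.choose_pos hkd).ne'
  have hd' : ((d + 1).choose k : K) ≠ 0 := by
    exact_mod_cast (Nat.choose_pos (Nat.le_succ_of_le hkd)).ne'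
  have h := congrArg (Nat.cast (R := K)) (Nat.choose_mul_succ_eq d k)
  rw [Nat.cast_mul, Nat.cast_mul, Nat.cast_sub (Nat.le_succ_of_le hkd), Nat.cast_succ] at h
  rw [div_eq_div_iff hd' hd, mul_comm, h, mul_comm]

theorem succ_div_choose_succ_eq {K : Type*} [Field K] [CharZero K] {d k : ℕ} (hkd : k ≤ d) :
    ((d : K) + 1) / (d + 1).choose (k + 1) = (k + 1) / d.choose k := by
  have hd : (d.choose k : K) ≠ 0 := by exact_mod_cast (Nat.choose_pos hkd).ne'
  have hd' : ((d + 1).choose (k + 1) : K) ≠ 0 := by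
    exact_mod_cast (Nat.choose_pos (Nat.succ_le_succ hkd)).ne'
  rw [div_eq_div_iff hd' hd, mul_comm ((k : K) + 1)]
  exact_mod_cast Nat.add_one_mul_choose_eq d k

theorem apolarPairing_X_sub_C_mul {K : Type*} [Field K] [CharZero K] {d : ℕ} {q : K[X]}
    (hq : q.natDegree ≤ d) (b : K) (f : K[X]) :
    (d + 1) * apolarPairing (d + 1) ((X - C b) * q) f =
      apolarPairing d q (polarDerivative (d + 1) (-b) f) := by
  have hX : ∀ k ∈ Finset.range (d + 1), ((X : K[X]) * q).coeff (d + 1 - k) = q.coeff (d - k) :=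
    fun k hk => by rw [Nat.succ_sub (Finset.mem_range_succ_iff.1 hk), coeff_X_mul]
  have hsplit : apolarPairing (d + 1) ((X - C b) * q) f = ∑ k ∈ Finset.range (d + 1),
      q.coeff (d - k) * (f.coeff k / (d + 1).choose k -
        b * f.coeff (k + 1) / (d + 1).choose (k + 1)) := by
    simp only [apolarPairing, sub_mul, coeff_sub, coeff_C_mul, sub_div, mul_sub,
      Finset.sum_sub_distrib]
    congr 1
    · rw [Finset.sum_range_succ, Nat.sub_self, mul_coeff_zero, coeff_X_zero, zero_mul, zero_mul,
        zero_div, add_zero]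
      exact Finset.sum_congr rfl fun k hk => by rw [hX k hk, mul_div_assoc]
    · rw [Finset.sum_range_succ', Nat.sub_zero, coeff_eq_zero_of_natDegree_lt (hq.trans_lt
        d.lt_succ_self), mul_zero, zero_mul, zero_div, add_zero]
      exact Finset.sum_congr rfl fun k _ => by rw [Nat.add_sub_add_right]; ring
  rw [hsplit, apolarPairing, Finset.mul_sum]
  refine Finset.sum_congr rfl fun k hk => ?_
  have hkd : k ≤ d := Finset.mem_range_succ_iff.1 hk
  rw [coeff_polarDerivative]
  push_cast
  linear_combination q.coeff (d - k) * (f.coeff k * succ_div_choose_eq (K := K) hkd -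
    b * f.coeff (k + 1) * succ_div_choose_succ_eq (K := K) hkd)

theorem im_mul_div_add_pos {u v : ℂ} (hu : 0 < u.im) (hv : 0 ≤ v.im) (hv₀ : v ≠ 0) :
    0 < (u * v / (u + v)).im := by
  have hu₀ : u ≠ 0 := fun h => by simp [h] at hu
  have hinv : u * v / (u + v) = (u⁻¹ + v⁻¹)⁻¹ := by
    rw [inv_add_inv hu₀ hv₀, inv_div]
  have hneg : (u⁻¹ + v⁻¹).im < 0 := by
    rw [Complex.add_im, Complex.inv_im, Complex.inv_im]
    exact add_neg_of_neg_of_nonpos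
      (div_neg_of_neg_of_pos (neg_neg_of_pos hu) (Complex.normSq_pos.2 hu₀))
      (div_nonpos_of_nonpos_of_nonneg (neg_nonpos.2 hv) (Complex.normSq_nonneg v))
  rw [hinv, Complex.inv_im]
  refine div_pos (neg_pos.2 hneg) (Complex.normSq_pos.2 fun h => ?_)
  rw [h, Complex.zero_im] at hneg
  exact hneg.false

theorem sum_map_im_pos {ι : Type*} {s : Multiset ι} (hs : s ≠ 0) {g : ι → ℂ}
    (hg : ∀ i ∈ s, 0 < (g i).im) : 0 < (s.map g).sum.im := by
  have h := Multiset.sum_lt_sum_of_nonempty hs hg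
  rw [Multiset.map_const', Multiset.sum_replicate, smul_zero] at h
  rwa [← Complex.coe_imAddGroupHom, map_multiset_sum, Multiset.map_map]

theorem eval_polarDerivative_eq_sum_roots {K : Type*} [Field K] {f : K[X]} (hf : f.Splits) {y : K}
    (hy : f.eval y ≠ 0) (α : K) : (polarDerivative f.natDegree α f).eval y =
      f.eval y * (f.roots.map fun z => (α - z) / (y - z)).sum := by
  have hterm : ∀ z ∈ f.roots, (α - z) / (y - z) = 1 - (y - α) * (1 / (y - z)) := fun z hz => by
    have hyz : y - z ≠ 0 := sub_ne_zero.2 fun h => hy (h ▸ (mem_roots'.1 hz).2)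
    field_simp
    ring
  rw [Multiset.map_congr rfl hterm, Multiset.sum_map_sub, Multiset.sum_map_mul_left,
    ← hf.eval_derivative_div_eval_of_ne_zero hy, Multiset.map_const', Multiset.sum_replicate,
    ← hf.natDegree_eq_card_roots, nsmul_one]
  simp only [polarDerivative, eval_sub, eval_mul, eval_natCast, eval_X, eval_C]
  field_simp

/-- For `y ≠ α` each term `(α - z) / (y - z)` of the sum over the roots `z` of `f` has a product
with `y - α` of positive imaginary part. -/
theorem eval_polarDerivative_ne_zero {f : ℂ[X]} (hf : 0 < f.natDegree)
    (hroots : ∀ z : ℂ, 0 ≤ z.im → f.eval z ≠ 0) (α : ℝ) {y : ℂ} (hy : 0 ≤ y.im) :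
    (polarDerivative f.natDegree (α : ℂ) f).eval y ≠ 0 := by
  have hfy := hroots y hy
  have hsplits : f.Splits := IsAlgClosed.splits f
  rcases eq_or_ne y α with rfl | hyα
  · simpa [polarDerivative] using ⟨hf.ne', hfy⟩
  have him : ∀ z ∈ f.roots, z.im < 0 := fun z hz =>
    not_le.1 fun hz' => hroots z hz' (mem_roots'.1 hz).2
  have hne : f.roots ≠ 0 :=
    Multiset.card_pos.1 (hsplits.natDegree_eq_card_roots ▸ hf)
  have hpos := sum_map_im_pos hne fun z hz => im_mul_div_add_pos (u := α - z) (v := y - α)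
    (by simpa using him z hz) (by simpa using hy) (sub_ne_zero.2 hyα)
  have hterm : ∀ z : ℂ, ((α : ℂ) - z) * (y - α) / (α - z + (y - α)) =
      (y - α) * ((α - z) / (y - z)) := fun z => by
    rw [sub_add_sub_cancel', mul_comm, mul_div_assoc]
  simp only [hterm, Multiset.sum_map_mul_left] at hpos
  rw [eval_polarDerivative_eq_sum_roots hsplits hfy]
  refine mul_ne_zero hfy fun h => ?_
  rw [h, mul_zero, Complex.zero_im] at hpos
  exact hpos.false

theorem natDegree_polarDerivative {f : ℂ[X]} {d : ℕ} (hf : f.natDegree = d + 1)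
    (hroots : ∀ z : ℂ, 0 ≤ z.im → f.eval z ≠ 0) (α : ℝ) :
    (polarDerivative (d + 1) (α : ℂ) f).natDegree = d := by
  have hsplits : f.Splits := IsAlgClosed.splits f
  have hcard := hsplits.natDegree_eq_card_roots
  have hlead : f.coeff (d + 1) ≠ 0 := by
    rw [← hf, coeff_natDegree, leadingCoeff_ne_zero]
    rintro rfl
    simp at hf
  refine natDegree_eq_of_le_of_coeff_ne_zero (natDegree_le_iff_coeff_eq_zero.2 fun k hk => ?_) ?_
  · rw [coeff_polarDerivative, coeff_eq_zero_of_natDegree_lt (n := k + 1) (by omega)]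
    rcases (Nat.succ_le_of_lt hk).eq_or_lt with rfl | hk'
    · simp
    · rw [coeff_eq_zero_of_natDegree_lt (by omega)]
      simp
  · have hne : f.roots ≠ 0 := fun h => by simp [h, hf] at hcard
    have hpos := sum_map_im_pos hne (g := fun z => (α : ℂ) - z) fun z hz => by
      by_contra hz'
      exact hroots z (by simpa using hz') (mem_roots'.1 hz).2
    have hnext := hsplits.nextCoeff_eq_neg_sum_roots_mul_leadingCoeff
    rw [nextCoeff_of_natDegree_pos (by omega), leadingCoeff, hf, Nat.add_sub_cancel] at hnext
    have hsum : (polarDerivative (d + 1) (α : ℂ) f).coeff d =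
        f.coeff (d + 1) * (f.roots.map fun z => (α : ℂ) - z).sum := by
      rw [coeff_polarDerivative, hnext, Multiset.sum_map_sub, Multiset.map_const',
        Multiset.sum_replicate, Multiset.map_id', ← hcard, hf, nsmul_eq_mul]
      push_cast
      ring
    rw [hsum]
    refine mul_ne_zero hlead fun h => ?_
    rw [h, Complex.zero_im] at hpos
    exact hpos.false

/-- The case of Grace's theorem in which one of the polynomials has real roots. -/
theorem apolarPairing_prod_X_sub_C_ne_zero (s : Multiset ℝ) {f : ℂ[X]}
    (hf : f.natDegree = s.card) (hroots : ∀ z : ℂ, 0 ≤ z.im → f.eval z ≠ 0) :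
    apolarPairing s.card (s.map fun b : ℝ => X - C (b : ℂ)).prod f ≠ 0 := by
  induction s using Multiset.induction_on generalizing f with
  | empty =>
    have hf₀ := hroots 0 le_rfl
    rw [← coeff_zero_eq_eval_zero] at hf₀
    simpa [apolarPairing] using hf₀
  | cons b s ih =>
    rw [Multiset.card_cons] at hf ⊢
    have hdeg := natDegree_polarDerivative hf hroots (-b)
    have hpolar := fun (y : ℂ) (hy : 0 ≤ y.im) =>
      eval_polarDerivative_ne_zero (hf ▸ Nat.succ_pos _) hroots (-b) hy
    rw [hf] at hpolar
    have hq := natDegree_multiset_prod_X_sub_C_eq_card (s.map ((↑) : ℝ → ℂ))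
    rw [Multiset.map_map, Multiset.card_map] at hq
    have hrec := apolarPairing_X_sub_C_mul hq.le (b : ℂ) f
    rw [Complex.ofReal_neg] at hdeg hpolar
    rw [Multiset.map_cons, Multiset.prod_cons]
    exact right_ne_zero_of_mul (hrec ▸ ih hdeg hpolar)

theorem splits_iff_forall_aeval_ne_zero {p : ℝ[X]} (hp : p ≠ 0) :
    p.Splits ↔ ∀ z : ℂ, 0 < z.im → aeval z p ≠ 0 := by
  constructor
  · intro h z hz hz₀
    have hmem : z ∈ p.aroots ℂ := (mem_aroots.2 ⟨hp, hz₀⟩)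
    rw [aroots, h.roots_map] at hmem
    obtain ⟨a, -, rfl⟩ := Multiset.mem_map.1 hmem
    simp at hz
  · intro h
    refine Splits.of_splits_map (algebraMap ℝ ℂ) (IsAlgClosed.splits _) fun z hz => ?_
    have hz₀ : aeval z p = 0 := (mem_aroots.1 hz).2
    rcases lt_trichotomy z.im 0 with hi | hi | hi
    · refine absurd ?_ (h (starRingEnd ℂ z) (by simpa using hi))
      rw [aeval_conj, hz₀, map_zero]
    · exact ⟨z.re, Complex.ext (by simp) (by simp [hi])⟩
    · exact absurd hz₀ (h z hi)

theorem aeval_addConv {d : ℕ} {p : ℝ[X]} (hp : p.natDegree ≤ d) (q : ℝ[X]) (x : ℂ) :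
    aeval x (addConv d p q) = apolarPairing d (q.map (algebraMap ℝ ℂ))
      (taylor x (p.map (algebraMap ℝ ℂ))) := by
  rw [addConv_eq_sum_hasseDeriv q hp, map_sum, apolarPairing]
  refine Finset.sum_congr rfl fun k _ => ?_
  have hmap : hasseDeriv k (p.map (algebraMap ℝ ℂ)) = (hasseDeriv k p).map (algebraMap ℝ ℂ) := by
    ext n
    simp [hasseDeriv_coeff]
  rw [map_mul, aeval_C, taylor_coeff, hmap, eval_map_algebraMap, coeff_map, map_div₀, map_natCast]
  ring

theorem IsMonicRealRooted.coeff_eq_one {d : ℕ} {p : ℝ[X]} (hp : IsMonicRealRooted d p) :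
    p.coeff d = 1 :=
  hp.natDegree_eq ▸ hp.monic.coeff_natDegree

theorem IsMonicRealRooted.card_roots {d : ℕ} {p : ℝ[X]} (hp : IsMonicRealRooted d p) :
    p.roots.card = d := by
  rw [← hp.splits.natDegree_eq_card_roots, hp.natDegree_eq]

theorem IsMonicRealRooted.prod_roots {d : ℕ} {p : ℝ[X]} (hp : IsMonicRealRooted d p) :
    (p.roots.map fun a => X - C a).prod = p :=
  (hp.splits.eq_prod_roots_of_monic hp.monic).symm

theorem IsMonicRealRooted.addConv {d : ℕ} {p q : ℝ[X]} (hp : IsMonicRealRooted d p)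
    (hq : IsMonicRealRooted d q) : IsMonicRealRooted d (addConv d p q) := by
  have hcoeff : (FiniteFree.addConv d p q).coeff d = 1 := by
    rw [coeff_addConv_self, hp.coeff_eq_one, hq.coeff_eq_one, mul_one]
  have hmonic := monic_of_natDegree_le_of_coeff_eq_one d (natDegree_addConv_le d p q) hcoeff
  have hdeg := natDegree_eq_of_le_of_coeff_ne_zero (natDegree_addConv_le d p q)
    (hcoeff ▸ one_ne_zero)
  refine ⟨hmonic, hdeg, (splits_iff_forall_aeval_ne_zero hmonic.ne_zero).2 fun x hx => ?_⟩
  set f := taylor x (p.map (algebraMap ℝ ℂ)) with hf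
  have hroots : ∀ z : ℂ, 0 ≤ z.im → f.eval z ≠ 0 := fun z hz => by
    rw [hf, taylor_eval, eval_map_algebraMap]
    exact (splits_iff_forall_aeval_ne_zero hp.monic.ne_zero).1 hp.splits _
      (by rw [Complex.add_im]; exact add_pos_of_nonneg_of_pos hz hx)
  have hfdeg : f.natDegree = q.roots.card := by
    rw [hf, natDegree_taylor, natDegree_map, hp.natDegree_eq, hq.card_roots]
  have hq_map : q.map (algebraMap ℝ ℂ) = (q.roots.map fun b : ℝ => X - C (b : ℂ)).prod := by
    conv_lhs => rw [← hq.prod_roots]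
    simp [Polynomial.map_multiset_prod, Multiset.map_map]
  have hgrace := apolarPairing_prod_X_sub_C_ne_zero q.roots hfdeg hroots
  rwa [hq.card_roots, ← hq_map, hf, ← aeval_addConv hp.natDegree_eq.le] at hgrace

end Grace

section Reversal

variable {R : Type*} [CommRing R]

/-- The power series of the reversed polynomial `z ^ d * p (1 / z)`, for `deg p ≤ d`. -/
noncomputable def revSeries (d : ℕ) (p : R[X]) : PowerSeries R :=
  (reflect d p : R[X])

theorem coeff_revSeries {d k : ℕ} (hk : k ≤ d) (p : R[X]) :
    PowerSeries.coeff k (revSeries d p) = p.coeff (d - k) := by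
  rw [revSeries, coeff_coe, coeff_reflect, revAt_le hk]

theorem constantCoeff_revSeries (d : ℕ) (p : R[X]) :
    PowerSeries.constantCoeff (revSeries d p) = p.coeff d := by
  rw [← PowerSeries.coeff_zero_eq_constantCoeff_apply, coeff_revSeries d.zero_le, Nat.sub_zero]

theorem revSeries_C_mul (d : ℕ) (a : R) (p : R[X]) :
    revSeries d (C a * p) = PowerSeries.C a * revSeries d p := by
  rw [revSeries, reflect_C_mul, coe_mul, coe_C, revSeries]

theorem revSeries_sum {ι : Type*} (s : Finset ι) (d : ℕ) (p : ι → R[X]) :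
    revSeries d (∑ i ∈ s, p i) = ∑ i ∈ s, revSeries d (p i) := by
  ext n
  simp only [revSeries, map_sum, coeff_coe, coeff_reflect, finsetSum_coeff]

theorem revSeries_mul {d e : ℕ} {p q : R[X]} (hp : p.natDegree ≤ d) (hq : q.natDegree ≤ e) :
    revSeries (d + e) (p * q) = revSeries d p * revSeries e q := by
  rw [revSeries, reflect_mul p q hp hq, coe_mul, revSeries, revSeries]

theorem revSeries_X_sub_C (b : R) :
    revSeries 1 (X - C b) = 1 - PowerSeries.C b * PowerSeries.X := by
  rw [revSeries, reflect_sub, reflect_one_X, reflect_C, pow_one, coe_sub, coe_one, coe_mul, coe_C,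
    coe_X]

theorem X_pow_mul_revSeries {d k : ℕ} (hk : k ≤ d) {p : R[X]} (hp : p.natDegree ≤ d - k) :
    PowerSeries.X ^ k * revSeries (d - k) p = revSeries d p := by
  have hone : revSeries k (1 : R[X]) = PowerSeries.X ^ k := by
    rw [revSeries, ← C_1, reflect_C, C_1, one_mul, coe_pow, coe_X]
  have hmul := revSeries_mul (d := k) (p := 1) (by simp) hp
  rw [one_mul, Nat.add_sub_cancel' hk, hone] at hmul
  exact hmul.symm

/-- Euler's relation for the homogenization of `p`. -/
theorem revSeries_derivative {e : ℕ} {p : R[X]} (hp : p.natDegree ≤ e + 1) :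
    revSeries e (derivative p) = PowerSeries.C ((e : R) + 1) * revSeries (e + 1) p -
      PowerSeries.X * PowerSeries.derivative R (revSeries (e + 1) p) := by
  rw [revSeries, revSeries, PowerSeries.derivative_coe, ← coe_C, ← coe_X, ← coe_mul, ← coe_mul,
    ← coe_sub]
  congr 1
  ext n
  have hX : ∀ f : R[X], (X * derivative f).coeff n = n * f.coeff n := fun f => by
    cases n with
    | zero => simp
    | succ n => rw [coeff_X_mul, coeff_derivative, Nat.cast_succ, mul_comm]
  rw [coeff_sub, coeff_C_mul, hX, coeff_reflect, coeff_reflect, coeff_derivative]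
  rcases lt_trichotomy n (e + 1) with h | rfl | h
  · rw [revAt_le (Nat.lt_succ_iff.1 h), revAt_le h.le, Nat.succ_sub (Nat.lt_succ_iff.1 h),
      Nat.cast_sub (Nat.lt_succ_iff.1 h)]
    ring
  · rw [revAt_eq_self_of_lt e.lt_succ_self, coeff_eq_zero_of_natDegree_lt (by omega)]
    push_cast
    ring
  · rw [revAt_eq_self_of_lt (e.lt_succ_self.trans h), revAt_eq_self_of_lt h,
      coeff_eq_zero_of_natDegree_lt (by omega), coeff_eq_zero_of_natDegree_lt (by omega)]
    ring

end Reversal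

section PowerSums

variable {R : Type*} [CommRing R]

/-- The generating function `∑ₙ pₙ₊₁ zⁿ` of the power sums `pₙ` of a multiset. -/
noncomputable def powerSumSeries (s : Multiset R) : PowerSeries R :=
  PowerSeries.mk fun n => (s.map fun a => a ^ (n + 1)).sum

theorem coeff_powerSumSeries (s : Multiset R) (n : ℕ) :
    PowerSeries.coeff n (powerSumSeries s) = (s.map fun a => a ^ (n + 1)).sum :=
  PowerSeries.coeff_mk _ _

theorem powerSumSeries_zero : powerSumSeries (0 : Multiset R) = 0 := by
  ext n
  simp [coeff_powerSumSeries]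

theorem powerSumSeries_cons (b : R) (s : Multiset R) :
    powerSumSeries (b ::ₘ s) = powerSumSeries {b} + powerSumSeries s := by
  ext n
  simp [coeff_powerSumSeries]

theorem one_sub_C_mul_X_mul_powerSumSeries_singleton (b : R) :
    (1 - PowerSeries.C b * PowerSeries.X) * powerSumSeries {b} = PowerSeries.C b := by
  ext n
  rw [sub_mul, one_mul, mul_assoc, map_sub, PowerSeries.coeff_C_mul, PowerSeries.coeff_C]
  cases n with
  | zero => simp [coeff_powerSumSeries]
  | succ n => simp [coeff_powerSumSeries, PowerSeries.coeff_succ_X_mul, pow_succ' b (n + 1)]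

theorem derivative_revSeries_prod_X_sub_C (s : Multiset R) :
    PowerSeries.derivative R (revSeries s.card (s.map fun b => X - C b).prod) =
      -(powerSumSeries s * revSeries s.card (s.map fun b => X - C b).prod) := by
  nontriviality R
  induction s using Multiset.induction_on with
  | empty => simp [powerSumSeries_zero, revSeries]
  | cons b s ih =>
    have hfactor : PowerSeries.derivative R (1 - PowerSeries.C b * PowerSeries.X) =
        -PowerSeries.C b := by
      simp [Derivation.leibniz]
    rw [Multiset.map_cons, Multiset.prod_cons, Multiset.card_cons, add_comm,
      revSeries_mul (natDegree_X_sub_C_le b) (natDegree_multiset_prod_X_sub_C_eq_card s).le,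
      revSeries_X_sub_C, Derivation.leibniz, ih, hfactor, powerSumSeries_cons, smul_eq_mul,
      smul_eq_mul]
    linear_combination revSeries s.card (s.map fun b => X - C b).prod *
      one_sub_C_mul_X_mul_powerSumSeries_singleton b

theorem IsMonicRealRooted.derivative_revSeries {d : ℕ} {p : ℝ[X]} (hp : IsMonicRealRooted d p) :
    PowerSeries.derivative ℝ (revSeries d p) = -(powerSumSeries p.roots * revSeries d p) := by
  simpa only [hp.prod_roots, hp.card_roots] using derivative_revSeries_prod_X_sub_C p.roots

end PowerSums

section DerivativeRatio

variable {R : Type*} [CommRing R]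

/-- The ratio of the reversals of `d⁻ᵏ p⁽ᵏ⁾` and of `p` when `c = 1 / d` and `P` is the power sum
series of the roots of `p`, see `revSeries_iterate_derivative`. -/
noncomputable def derivRatio (c : R) (P : PowerSeries R) : ℕ → PowerSeries R
  | 0 => 1
  | k + 1 => derivRatio c P k * (1 + PowerSeries.C c * (PowerSeries.X * P)) -
      PowerSeries.C c * ((k : PowerSeries R) * derivRatio c P k +
        PowerSeries.X * PowerSeries.derivative R (derivRatio c P k))

theorem revSeries_iterate_derivative {d : ℕ} {p : R[X]} (hp : p.natDegree ≤ d)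
    {P : PowerSeries R}
    (hP : PowerSeries.derivative R (revSeries d p) = -(P * revSeries d p)) {c : R}
    (hc : (d : R) * c = 1) {k : ℕ} (hk : k ≤ d) :
    revSeries (d - k) (derivative^[k] p) =
      PowerSeries.C ((d : R) ^ k) * derivRatio c P k * revSeries d p := by
  induction k with
  | zero => simp [derivRatio]
  | succ k ih =>
    have hdeg : (derivative^[k] p).natDegree ≤ d - (k + 1) + 1 :=
      (natDegree_iterate_derivative p k).trans (by omega)
    have hcast : ((d - (k + 1) : ℕ) : R) + 1 = d - k := by
      rw [Nat.cast_sub hk, Nat.cast_succ]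
      ring
    have hCc : PowerSeries.C (d : R) * PowerSeries.C c = 1 := by rw [← map_mul, hc, map_one]
    rw [Function.iterate_succ_apply', revSeries_derivative hdeg,
      show d - (k + 1) + 1 = d - k by omega, ih (Nat.le_of_succ_le hk), derivRatio, hcast,
      mul_assoc (PowerSeries.C _), Derivation.leibniz, Derivation.leibniz, hP,
      PowerSeries.derivative_C, pow_succ, map_mul, map_sub, map_natCast, map_natCast]
    simp only [smul_eq_mul]
    rw [map_natCast] at hCc
    linear_combination PowerSeries.C ((d : R) ^ k) * revSeries d p * (k * derivRatio c P k +
      PowerSeries.X * PowerSeries.derivative R (derivRatio c P k) -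
        derivRatio c P k * (PowerSeries.X * P)) * hCc

theorem hasseDeriv_eq_C_mul_iterate_derivative {K : Type*} [Field K] [CharZero K] (k : ℕ)
    (p : K[X]) : hasseDeriv k p = C ((k.factorial : K)⁻¹) * derivative^[k] p := by
  rw [← factorial_smul_hasseDeriv, LinearMap.smul_apply, nsmul_eq_mul, ← C_eq_natCast,
    ← mul_assoc, ← C_mul, inv_mul_cancel₀ (Nat.cast_ne_zero.2 k.factorial_ne_zero), C_1, one_mul]

theorem revSeries_addConv {d : ℕ} (hd : d ≠ 0) {p : ℝ[X]} (q : ℝ[X]) (hp : p.natDegree ≤ d)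
    {P : PowerSeries ℝ}
    (hP : PowerSeries.derivative ℝ (revSeries d p) = -(P * revSeries d p)) :
    revSeries d (addConv d p q) = (∑ k ∈ Finset.range (d + 1),
      PowerSeries.C (PowerSeries.coeff k (revSeries d q) * ((d : ℝ) ^ k / d.descFactorial k)) *
        (PowerSeries.X ^ k * derivRatio (1 / d : ℝ) P k)) * revSeries d p := by
  rw [addConv_eq_sum_hasseDeriv q hp, revSeries_sum, Finset.sum_mul]
  refine Finset.sum_congr rfl fun k hk => ?_
  have hk : k ≤ d := Finset.mem_range_succ_iff.1 hk
  have hdeg : (derivative^[k] p).natDegree ≤ d - k :=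
    (natDegree_iterate_derivative p k).trans (Nat.sub_le_sub_right hp k)
  have hd₀ : (d : ℝ) ≠ 0 := Nat.cast_ne_zero.2 hd
  have hweight : q.coeff (d - k) / d.choose k * ((k.factorial : ℝ)⁻¹ * (d : ℝ) ^ k) =
      q.coeff (d - k) * ((d : ℝ) ^ k / d.descFactorial k) := by
    rw [Nat.descFactorial_eq_factorial_mul_choose, Nat.cast_mul]
    field_simp
  rw [revSeries_C_mul, hasseDeriv_eq_C_mul_iterate_derivative, revSeries_C_mul,
    ← X_pow_mul_revSeries hk hdeg,
    revSeries_iterate_derivative hp hP (mul_one_div_cancel hd₀) hk,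
    coeff_revSeries hk, ← hweight, map_mul, map_mul]
  ring

end DerivativeRatio

section LogarithmicDerivative

theorem ncDeriv_empty {R α : Type*} [CommSemiring R] [LinearOrder α] (r f : ℕ → R) :
    ncDeriv r f (∅ : Finset α) = 0 := by
  rw [← eval_zero_derivative_ncSum, ncSum_empty, derivative_one, eval_zero]

theorem constantCoeff_subst {R : Type*} [CommRing R] {w : PowerSeries R}
    (hw : PowerSeries.constantCoeff w = 0) (F : PowerSeries R) :
    PowerSeries.constantCoeff (F.subst w) = PowerSeries.constantCoeff F := by
  rw [← PowerSeries.coeff_zero_eq_constantCoeff_apply, coeff_subst_eq_sum hw F Nat.zero_lt_one]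
  simp

theorem mk_ncDeriv_succ {R : Type*} [CommRing R] [IsDomain R] {r f : ℕ → R} (hr : r 0 = 1)
    (hf : f 0 = 0) :
    (PowerSeries.mk fun n => ncDeriv r f (Finset.range (n + 1))) =
      (PowerSeries.mk fun n => f (n + 1)).subst (PowerSeries.X * ncSeries r) *
        PowerSeries.derivative R (PowerSeries.X * ncSeries r) := by
  have hX : ∀ g : ℕ → R, g 0 = 0 →
      PowerSeries.mk g = PowerSeries.X * PowerSeries.mk fun n => g (n + 1) := fun g hg => by
    simpa [hg] using PowerSeries.sub_const_eq_X_mul_shift (PowerSeries.mk g)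
  have hne : PowerSeries.X * ncSeries r ≠ 0 := by
    refine mul_ne_zero PowerSeries.X_ne_zero fun h => ?_
    simpa [h] using constantCoeff_ncSeries r
  have hw : PowerSeries.HasSubst (PowerSeries.X * ncSeries r) :=
    .of_constantCoeff_zero' (by simp)
  have h := ncDerivSeries_mul_ncSeries hr hf
  rw [ncDerivSeries, hX _ (ncDeriv_empty r f), hX f hf, PowerSeries.subst_mul hw,
    PowerSeries.subst_X hw] at h
  refine mul_left_cancel₀ hne ?_
  linear_combination h

theorem derivative_subst_ncSeries {R : Type*} [CommRing R] [IsDomain R] {r f : ℕ → R}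
    (hr : r 0 = 1) (hf : f 0 = 0) {E : PowerSeries R}
    (hE : PowerSeries.derivative R E = -((PowerSeries.mk fun n => f (n + 1)) * E)) :
    PowerSeries.derivative R (E.subst (PowerSeries.X * ncSeries r)) =
      -((PowerSeries.mk fun n => ncDeriv r f (Finset.range (n + 1))) *
        E.subst (PowerSeries.X * ncSeries r)) := by
  have hw : PowerSeries.HasSubst (PowerSeries.X * ncSeries r) :=
    .of_constantCoeff_zero' (by simp)
  rw [PowerSeries.derivative_subst hw, hE, mk_ncDeriv_succ hr hf,
    ← PowerSeries.coe_substAlgHom hw, map_neg, map_mul]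
  ring

theorem exists_derivative_eq_neg_mul {R : Type*} [Field R] [CharZero R] (N : PowerSeries R) :
    ∃ E : PowerSeries R, PowerSeries.derivative R E = -(N * E) ∧
      PowerSeries.constantCoeff E = 1 := by
  let g : PowerSeries R :=
    PowerSeries.X * PowerSeries.mk fun n => -PowerSeries.coeff n N / (n + 1)
  have hg : PowerSeries.constantCoeff g = 0 := by simp [g]
  have hg' : PowerSeries.derivative R g = -N := by
    ext n
    rw [PowerSeries.coeff_derivative, PowerSeries.coeff_succ_X_mul, PowerSeries.coeff_mk, map_neg,
      div_mul_cancel₀ _ (Nat.cast_add_one_ne_zero n)]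
  refine ⟨(PowerSeries.exp R).subst g, ?_, ?_⟩
  · rw [PowerSeries.derivative_subst (.of_constantCoeff_zero' hg), PowerSeries.derivative_exp, hg',
      mul_neg, mul_comm]
  · rw [constantCoeff_subst hg, PowerSeries.constantCoeff_exp]

end LogarithmicDerivative

section Limits

open scoped PowerSeries.WithPiTopology

variable {ι R : Type*} {l : Filter ι} [TopologicalSpace R]

theorem continuous_powerSeries_derivative [CommRing R] [IsTopologicalRing R] :
    Continuous (PowerSeries.derivative R : PowerSeries R → PowerSeries R) :=
  continuous_iff_continuousAt.2 fun F => by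
    refine (PowerSeries.WithPiTopology.tendsto_iff_coeff_tendsto R _ _ _).2 fun n => ?_
    simp only [PowerSeries.coeff_derivative]
    exact ((PowerSeries.WithPiTopology.continuous_coeff R (n + 1)).tendsto F).mul_const _

theorem tendsto_of_derivative_eq_neg_mul [Field R] [CharZero R] [IsTopologicalRing R]
    {P Q : ι → PowerSeries R} {N E : PowerSeries R}
    (hQ : ∀ᶠ i in l, PowerSeries.derivative R (Q i) = -(P i * Q i))
    (hQ₀ : ∀ᶠ i in l, PowerSeries.constantCoeff (Q i) = 1) (hP : Tendsto P l (𝓝 N))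
    (hE : PowerSeries.derivative R E = -(N * E)) (hE₀ : PowerSeries.constantCoeff E = 1) :
    Tendsto Q l (𝓝 E) := by
  have hrec : ∀ {P Q : PowerSeries R}, PowerSeries.derivative R Q = -(P * Q) → ∀ n,
      PowerSeries.coeff (n + 1) Q = -(∑ x ∈ Finset.HasAntidiagonal.antidiagonal n,
        PowerSeries.coeff x.1 P * PowerSeries.coeff x.2 Q) / (n + 1) := by
    intro P Q h n
    rw [← PowerSeries.coeff_mul, ← map_neg, ← h, PowerSeries.coeff_derivative,
      mul_div_cancel_right₀ _ (Nat.cast_add_one_ne_zero n)]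
  rw [PowerSeries.WithPiTopology.tendsto_iff_coeff_tendsto] at hP ⊢
  intro n
  induction n using Nat.strong_induction_on with
  | _ n ih =>
    cases n with
    | zero =>
      simp only [PowerSeries.coeff_zero_eq_constantCoeff_apply, hE₀]
      exact tendsto_const_nhds.congr' (hQ₀.mono fun i hi => hi.symm)
    | succ n =>
      rw [hrec hE]
      refine Tendsto.congr' (hQ.mono fun i hi => (hrec hi n).symm) ?_
      refine (tendsto_finsetSum _ fun x hx => (hP x.1).mul (ih x.2 ?_)).neg.div_const _
      have := Finset.HasAntidiagonal.mem_antidiagonal.1 hx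
      omega

theorem tendsto_of_tendsto_mul_of_constantCoeff_eq_one [CommRing R] [IsTopologicalRing R]
    {A Q : ι → PowerSeries R} {B E : PowerSeries R}
    (hQ₀ : ∀ᶠ i in l, PowerSeries.constantCoeff (Q i) = 1) (hE₀ : PowerSeries.constantCoeff E = 1)
    (hQ : Tendsto Q l (𝓝 E)) (hAQ : Tendsto (fun i => A i * Q i) l (𝓝 (B * E))) :
    Tendsto A l (𝓝 B) := by
  have hrec : ∀ {A Q : PowerSeries R}, PowerSeries.constantCoeff Q = 1 → ∀ n,
      PowerSeries.coeff n A = PowerSeries.coeff n (A * Q) - ∑ i ∈ Finset.range n,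
        PowerSeries.coeff i A * PowerSeries.coeff (n - i) Q := by
    intro A Q hQ n
    rw [PowerSeries.coeff_mul, Finset.Nat.sum_antidiagonal_eq_sum_range_succ_mk,
      Finset.sum_range_succ, Nat.sub_self, PowerSeries.coeff_zero_eq_constantCoeff_apply, hQ]
    ring
  rw [PowerSeries.WithPiTopology.tendsto_iff_coeff_tendsto] at hQ hAQ ⊢
  intro n
  induction n using Nat.strong_induction_on with
  | _ n ih =>
    rw [hrec hE₀]
    refine Tendsto.congr' (hQ₀.mono fun i hi => (hrec hi n).symm) ?_
    exact (hAQ n).sub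
      (tendsto_finsetSum _ fun i hi => (ih i (Finset.mem_range.1 hi)).mul (hQ (n - i)))

theorem tendsto_of_derivative_eq_neg_mul_of_tendsto [CommRing R] [IsTopologicalRing R]
    {P Q : ι → PowerSeries R} {N E : PowerSeries R}
    (hQ : ∀ᶠ i in l, PowerSeries.derivative R (Q i) = -(P i * Q i))
    (hQ₀ : ∀ᶠ i in l, PowerSeries.constantCoeff (Q i) = 1) (hQE : Tendsto Q l (𝓝 E))
    (hE : PowerSeries.derivative R E = -(N * E)) (hE₀ : PowerSeries.constantCoeff E = 1) :
    Tendsto P l (𝓝 N) := by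
  refine tendsto_of_tendsto_mul_of_constantCoeff_eq_one hQ₀ hE₀ hQE ?_
  have hneg := ((continuous_powerSeries_derivative.tendsto E).comp hQE).neg
  rw [hE, neg_neg] at hneg
  exact hneg.congr' (hQ.mono fun i hi => neg_eq_iff_eq_neg.2 hi)

theorem tendsto_derivRatio [CommRing R] [IsTopologicalRing R] {c : ι → R} {P : ι → PowerSeries R}
    {M : PowerSeries R} (hc : Tendsto c l (𝓝 0))
    (hM : Tendsto (fun i => 1 + PowerSeries.C (c i) * (PowerSeries.X * P i)) l (𝓝 M)) (k : ℕ) :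
    Tendsto (fun i => derivRatio (c i) (P i) k) l (𝓝 (M ^ k)) := by
  induction k with
  | zero => exact tendsto_const_nhds
  | succ k ih =>
    have hC : Tendsto (fun i => PowerSeries.C (c i)) l (𝓝 0) :=
      (PowerSeries.WithPiTopology.continuous_C.tendsto' 0 0 (map_zero _)).comp hc
    have herror := hC.mul ((ih.const_mul (k : PowerSeries R)).add
      (((continuous_powerSeries_derivative.tendsto _).comp ih).const_mul PowerSeries.X))
    have hlim := (ih.mul hM).sub herror
    rw [zero_mul, sub_zero, ← pow_succ] at hlim
    exact hlim

theorem tendsto_sum_C_mul_X_pow_mul [CommRing R] [IsTopologicalRing R] {a : ℕ → ℕ → R}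
    {G : ℕ → ℕ → PowerSeries R} {M E : PowerSeries R}
    (ha : ∀ k, Tendsto (fun d => a d k) atTop (𝓝 (PowerSeries.coeff k E)))
    (hG : ∀ k, Tendsto (fun d => G d k) atTop (𝓝 (M ^ k))) :
    Tendsto (fun d => ∑ k ∈ Finset.range (d + 1),
      PowerSeries.C (a d k) * (PowerSeries.X ^ k * G d k)) atTop
      (𝓝 (E.subst (PowerSeries.X * M))) := by
  refine (PowerSeries.WithPiTopology.tendsto_iff_coeff_tendsto R _ _ _).2 fun n => ?_
  rw [coeff_subst_eq_sum (by simp) E n.lt_succ_self]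
  have hlim : Tendsto (fun d => ∑ k ∈ Finset.range (n + 1),
      a d k * PowerSeries.coeff n (PowerSeries.X ^ k * G d k)) atTop
      (𝓝 (∑ k ∈ Finset.range (n + 1),
        PowerSeries.coeff k E * PowerSeries.coeff n ((PowerSeries.X * M) ^ k))) := by
    refine tendsto_finsetSum _ fun k _ => (ha k).mul ?_
    rw [mul_pow]
    exact ((PowerSeries.WithPiTopology.continuous_coeff R n).tendsto _).comp
      ((hG k).const_mul _)
  refine hlim.congr' ?_
  filter_upwards [eventually_ge_atTop n] with d hd
  simp only [map_sum, PowerSeries.coeff_C_mul]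
  refine Finset.sum_subset (Finset.range_mono (Nat.succ_le_succ hd)) fun k _ hk => ?_
  rw [Finset.mem_range, not_lt] at hk
  rw [coeff_pow_mul_eq_zero PowerSeries.constantCoeff_X _ hk, mul_zero]

end Limits

section PowerSumAsymptotics

open scoped PowerSeries.WithPiTopology

theorem tendsto_pow_div_descFactorial (k : ℕ) :
    Tendsto (fun d : ℕ => (d : ℝ) ^ k / d.descFactorial k) atTop (𝓝 1) := by
  have hne : ∀ᶠ d : ℕ in atTop, (d.descFactorial k : ℝ) ≠ 0 := by
    filter_upwards [eventually_ge_atTop k] with d hd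
    exact_mod_cast (Nat.descFactorial_pos.2 hd).ne'
  exact (Asymptotics.isEquivalent_iff_tendsto_one hne).1 (isEquivalent_descFactorial k).symm

/-- The ratio of the reversals of `p ⊞_d q` and of `p`, see `revSeries_addConv`. -/
noncomputable def addConvRatio (d : ℕ) (p q : ℝ[X]) : PowerSeries ℝ :=
  ∑ k ∈ Finset.range (d + 1),
    PowerSeries.C (PowerSeries.coeff k (revSeries d q) * ((d : ℝ) ^ k / d.descFactorial k)) *
      (PowerSeries.X ^ k * derivRatio (1 / d : ℝ) (powerSumSeries p.roots) k)

theorem IsMonicRealRooted.revSeries_addConv {d : ℕ} {p : ℝ[X]} (hp : IsMonicRealRooted d p)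
    (hd : d ≠ 0) (q : ℝ[X]) :
    revSeries d (FiniteFree.addConv d p q) = addConvRatio d p q * revSeries d p :=
  FiniteFree.revSeries_addConv hd q hp.natDegree_eq.le hp.derivative_revSeries

theorem IsMonicRealRooted.constantCoeff_revSeries {d : ℕ} {p : ℝ[X]}
    (hp : IsMonicRealRooted d p) : PowerSeries.constantCoeff (revSeries d p) = 1 := by
  rw [FiniteFree.constantCoeff_revSeries, hp.coeff_eq_one]

theorem constantCoeff_addConvRatio {d : ℕ} {p q : ℝ[X]} (hd : d ≠ 0) (hp : IsMonicRealRooted d p)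
    (hq : IsMonicRealRooted d q) : PowerSeries.constantCoeff (addConvRatio d p q) = 1 := by
  have h := congrArg PowerSeries.constantCoeff (hp.revSeries_addConv hd q)
  rw [map_mul, hp.constantCoeff_revSeries, (hp.addConv hq).constantCoeff_revSeries, mul_one] at h
  exact h.symm

theorem derivative_addConvRatio {d : ℕ} {p q : ℝ[X]} (hd : d ≠ 0) (hp : IsMonicRealRooted d p)
    (hq : IsMonicRealRooted d q) : PowerSeries.derivative ℝ (addConvRatio d p q) =
      -((powerSumSeries (addConv d p q).roots - powerSumSeries p.roots) *
        addConvRatio d p q) := by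
  have hne : revSeries d p ≠ 0 := fun h => by simpa [h] using hp.constantCoeff_revSeries
  have h := (hp.addConv hq).derivative_revSeries
  rw [hp.revSeries_addConv hd, Derivation.leibniz, hp.derivative_revSeries, smul_eq_mul,
    smul_eq_mul] at h
  refine mul_left_cancel₀ hne ?_
  linear_combination h

theorem tendsto_addConvRatio {p q : ℕ → ℝ[X]} {M E : PowerSeries ℝ}
    (hp : Tendsto (fun d : ℕ => 1 + PowerSeries.C (1 / (d : ℝ)) *
      (PowerSeries.X * powerSumSeries (p d).roots)) atTop (𝓝 M))
    (hq : Tendsto (fun d => revSeries d (q d)) atTop (𝓝 E)) :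
    Tendsto (fun d => addConvRatio d (p d) (q d)) atTop (𝓝 (E.subst (PowerSeries.X * M))) := by
  refine tendsto_sum_C_mul_X_pow_mul (fun k => ?_)
    (tendsto_derivRatio tendsto_one_div_atTop_nhds_zero_nat hp)
  simpa only [mul_one] using
    ((PowerSeries.WithPiTopology.tendsto_iff_coeff_tendsto ℝ _ _ _).1 hq k).mul
      (tendsto_pow_div_descFactorial k)

theorem tendsto_powerSumSeries_addConv_sub {p q : ℕ → ℝ[X]} {r f : ℕ → ℝ}
    (hp : ∀ d, 1 ≤ d → IsMonicRealRooted d (p d)) (hq : ∀ d, 1 ≤ d → IsMonicRealRooted d (q d))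
    (hr : r 0 = 1) (hf : f 0 = 0)
    (hpr : Tendsto (fun d : ℕ => 1 + PowerSeries.C (1 / (d : ℝ)) *
      (PowerSeries.X * powerSumSeries (p d).roots)) atTop (𝓝 (ncSeries r)))
    (hqf : Tendsto (fun d => powerSumSeries (q d).roots) atTop
      (𝓝 (PowerSeries.mk fun n => f (n + 1)))) :
    Tendsto (fun d => powerSumSeries (addConv d (p d) (q d)).roots - powerSumSeries (p d).roots)
      atTop (𝓝 (PowerSeries.mk fun n => ncDeriv r f (Finset.range (n + 1)))) := by
  obtain ⟨E, hE, hE₀⟩ := exists_derivative_eq_neg_mul (PowerSeries.mk fun n => f (n + 1))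
  have hpos := eventually_ge_atTop 1
  have hqE : Tendsto (fun d => revSeries d (q d)) atTop (𝓝 E) :=
    tendsto_of_derivative_eq_neg_mul (hpos.mono fun d hd => (hq d hd).derivative_revSeries)
      (hpos.mono fun d hd => (hq d hd).constantCoeff_revSeries) hqf hE hE₀
  refine tendsto_of_derivative_eq_neg_mul_of_tendsto
    (hpos.mono fun d hd =>
      derivative_addConvRatio (Nat.one_le_iff_ne_zero.1 hd) (hp d hd) (hq d hd))
    (hpos.mono fun d hd =>
      constantCoeff_addConvRatio (Nat.one_le_iff_ne_zero.1 hd) (hp d hd) (hq d hd))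
    (tendsto_addConvRatio hpr hqE) (derivative_subst_ncSeries hr hf hE) ?_
  rw [constantCoeff_subst (by simp), hE₀]

end PowerSumAsymptotics

section Moments

theorem integrable_sum_dirac (s : Multiset ℝ) (g : ℝ → ℝ) :
    Integrable g (s.map fun a : ℝ => Measure.dirac a).sum := by
  induction s using Multiset.induction_on with
  | empty => simp
  | cons a s ih =>
    rw [Multiset.map_cons, Multiset.sum_cons]
    exact (integrable_dirac enorm_lt_top).add_measure ih

theorem integral_sum_dirac (s : Multiset ℝ) (g : ℝ → ℝ) :
    ∫ t, g t ∂(s.map fun a : ℝ => Measure.dirac a).sum = (s.map g).sum := by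
  induction s using Multiset.induction_on with
  | empty => simp
  | cons a s ih =>
    simp only [Multiset.map_cons, Multiset.sum_cons]
    rw [integral_add_measure (integrable_dirac enorm_lt_top) (integrable_sum_dirac s g), ih,
      integral_dirac]

theorem mom_rootDistribution (p : ℝ[X]) (n : ℕ) :
    mom (rootDistribution p) n = 1 / (p.natDegree : ℝ) * (p.roots.map fun a => a ^ n).sum := by
  rw [mom, ProbabilityTheory.moment, rootDistribution, integral_smul_measure, ENNReal.toReal_inv,
    ENNReal.toReal_natCast, smul_eq_mul, one_div]
  exact congrArg _ (integral_sum_dirac p.roots fun t => t ^ n)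

variable {d : ℕ} {p : ℝ[X]}

theorem IsMonicRealRooted.mom_zero (hp : IsMonicRealRooted d p) (hd : d ≠ 0) :
    mom (rootDistribution p) 0 = 1 := by
  simp [mom_rootDistribution, hp.natDegree_eq, hp.card_roots, hd]

theorem IsMonicRealRooted.mom_succ (hp : IsMonicRealRooted d p) (n : ℕ) :
    mom (rootDistribution p) (n + 1) = 1 / d * PowerSeries.coeff n (powerSumSeries p.roots) := by
  rw [mom_rootDistribution, hp.natDegree_eq, coeff_powerSumSeries]

theorem IsMonicRealRooted.mul_mom_succ (hp : IsMonicRealRooted d p) (hd : d ≠ 0) (n : ℕ) :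
    d * mom (rootDistribution p) (n + 1) = PowerSeries.coeff n (powerSumSeries p.roots) := by
  rw [hp.mom_succ, ← mul_assoc, mul_one_div_cancel (Nat.cast_ne_zero.2 hd), one_mul]

theorem IsLawWithMoments.mom_zero {μ : Measure ℝ} (hμ : IsLawWithMoments μ) : mom μ 0 = 1 := by
  have := hμ.isProb
  simp [mom, ProbabilityTheory.moment]

theorem mom_dirac_zero : mom (Measure.dirac 0) = Pi.single 0 1 := by
  ext n
  cases n <;> simp [mom, ProbabilityTheory.moment]

end Moments

section Cumulants

variable {m m' h : ℕ → ℝ} {n : ℕ}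

/-- The sequence of free cumulants, with the value `1` at `0` as required of the coefficients of
the `R`-transform in `ncSeries_eq_subst`. -/
noncomputable def cumulantSeq (m : ℕ → ℝ) : ℕ → ℝ :=
  Function.update (freeCumulant m) 0 1

/-- The sequence of infinitesimal free cumulants, with the value `0` at `0`: it is a direction of
variation of `cumulantSeq m`. -/
noncomputable def infCumulantSeq (m m' : ℕ → ℝ) : ℕ → ℝ :=
  Function.update (infFreeCumulant m m') 0 0

theorem cumulantSeq_zero (m : ℕ → ℝ) : cumulantSeq m 0 = 1 := Function.update_self _ _ _

theorem cumulantSeq_of_ne_zero (m : ℕ → ℝ) (hn : n ≠ 0) : cumulantSeq m n = freeCumulant m n :=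
  Function.update_of_ne hn _ _

theorem infCumulantSeq_zero (m m' : ℕ → ℝ) : infCumulantSeq m m' 0 = 0 :=
  Function.update_self _ _ _

theorem infCumulantSeq_of_ne_zero (m m' : ℕ → ℝ) (hn : n ≠ 0) :
    infCumulantSeq m m' n = infFreeCumulant m m' n :=
  Function.update_of_ne hn _ _

theorem card_ne_zero_of_mem_parts {α : Type*} [DecidableEq α] {s V : Finset α}
    {π : Finpartition s} (hV : V ∈ π.parts) : V.card ≠ 0 :=
  Finset.card_ne_zero.2 (π.nonempty_of_mem_parts hV)

theorem moment_eq_ncSum (m : ℕ → ℝ) (hn : n ≠ 0) :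
    m n = ncSum (cumulantSeq m) (Finset.range n) := by
  rw [← ncSum_univ_fin, ncSum, ← sum_NC_eq_sum_ncParts (fun P => ∏ V ∈ P, cumulantSeq m V.card),
    moment_cumulant m (Nat.one_le_iff_ne_zero.2 hn)]
  exact Finset.sum_congr rfl fun π _ => Finset.prod_congr rfl fun V hV =>
    (cumulantSeq_of_ne_zero m (card_ne_zero_of_mem_parts hV)).symm

theorem ncSeries_cumulantSeq (hm : m 0 = 1) : ncSeries (cumulantSeq m) = PowerSeries.mk m := by
  ext n
  rw [coeff_ncSeries, PowerSeries.coeff_mk]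
  rcases eq_or_ne n 0 with rfl | hn
  · rw [Finset.range_zero, ncSum_empty, hm]
  · exact (moment_eq_ncSum m hn).symm

open Classical in
theorem ncDeriv_cumulantSeq (m h : ℕ → ℝ) (n : ℕ) :
    ncDeriv (cumulantSeq m) h (Finset.range n) = ∑ π ∈ NC n, ∑ V ∈ π.parts,
      h V.card * ∏ W ∈ π.parts.erase V, freeCumulant m W.card := by
  rw [← ncDeriv_univ_fin, ncDeriv]
  refine (sum_NC_eq_sum_ncParts _).symm.trans ?_
  refine Finset.sum_congr rfl fun π _ => Finset.sum_congr rfl fun V _ => congrArg _ ?_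
  refine Finset.prod_congr (by congr!) fun W hW => cumulantSeq_of_ne_zero m ?_
  exact card_ne_zero_of_mem_parts (Finset.mem_of_mem_erase hW)

theorem infMoment_eq_ncDeriv (m m' : ℕ → ℝ) (hn : n ≠ 0) :
    m' n = ncDeriv (cumulantSeq m) (infCumulantSeq m m') (Finset.range n) := by
  rw [ncDeriv_cumulantSeq, inf_moment_cumulant m m' (Nat.one_le_iff_ne_zero.2 hn)]
  refine Finset.sum_congr rfl fun π _ => Finset.sum_congr rfl fun V hV => ?_
  rw [infCumulantSeq_of_ne_zero _ _ (card_ne_zero_of_mem_parts hV)]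

theorem infFreeCumulant_eq_of_forall_eq_ncDeriv
    (hm : ∀ n, n ≠ 0 → m' n = ncDeriv (cumulantSeq m) h (Finset.range n)) (hn : n ≠ 0) :
    infFreeCumulant m m' n = h n := by
  classical
  induction n using Nat.strong_induction_on with
  | _ n ih =>
    have hn₁ : 1 ≤ n := Nat.one_le_iff_ne_zero.2 hn
    have hsum := (inf_moment_cumulant m m' hn₁).symm.trans
      ((hm n hn).trans (ncDeriv_cumulantSeq m h n))
    rw [sum_NC hn₁ (fun P => ∑ V ∈ P, infFreeCumulant m m' V.card *
        ∏ W ∈ P.erase V, freeCumulant m W.card),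
      sum_NC hn₁ (fun P => ∑ V ∈ P, h V.card * ∏ W ∈ P.erase V, freeCumulant m W.card)] at hsum
    have hproper : ∑ π ∈ properNC n, ∑ V ∈ π.parts, infFreeCumulant m m' V.card *
        ∏ W ∈ π.parts.erase V, freeCumulant m W.card = ∑ π ∈ properNC n, ∑ V ∈ π.parts,
        h V.card * ∏ W ∈ π.parts.erase V, freeCumulant m W.card :=
      Finset.sum_congr rfl fun π hπ => Finset.sum_congr rfl fun V hV => by
        rw [ih _ (card_lt_of_mem_properNC hπ hV) (card_ne_zero_of_mem_parts hV)]
    simpa [hproper] using hsum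

theorem ncSeries_cumulantSeq_single : ncSeries (cumulantSeq (Pi.single 0 1)) = 1 := by
  rw [ncSeries_cumulantSeq (Pi.single_eq_same _ _)]
  ext n
  rw [PowerSeries.coeff_mk, PowerSeries.coeff_one, Pi.single_apply]

theorem freeCumulant_single (hn : n ≠ 0) : freeCumulant (Pi.single 0 1) n = 0 := by
  have hR := congrArg (PowerSeries.coeff n) (ncSeries_eq_subst (cumulantSeq_zero (Pi.single 0 1)))
  rwa [ncSeries_cumulantSeq_single, mul_one, PowerSeries.X_subst, PowerSeries.coeff_mk,
    PowerSeries.coeff_one, if_neg hn, cumulantSeq_of_ne_zero _ hn, eq_comm] at hR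

theorem infFreeCumulant_single (m' : ℕ → ℝ) (hn : n ≠ 0) :
    infFreeCumulant (Pi.single 0 1) m' n = m' n := by
  have hR := congrArg (PowerSeries.coeff n) (ncDerivSeries_mul_ncSeries
    (cumulantSeq_zero (Pi.single 0 1)) (infCumulantSeq_zero (Pi.single 0 1) m'))
  rw [ncSeries_cumulantSeq_single, mul_one, mul_one, PowerSeries.X_subst, PowerSeries.derivative_X,
    mul_one, coeff_ncDerivSeries, ← infMoment_eq_ncDeriv _ m' hn, PowerSeries.coeff_mk,
    infCumulantSeq_of_ne_zero _ _ hn] at hR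
  exact hR.symm

end Cumulants

section InfinitesimalConvolution

open scoped PowerSeries.WithPiTopology

variable {p q s : ℕ → ℝ[X]} {μ γ : Measure ℝ} {μ' ν' γ' : ℝ[X] →ₗ[ℝ] ℝ}

theorem exists_linearMap_X_pow_eq {R M : Type*} [CommSemiring R] [AddCommMonoid M] [Module R M]
    (g : ℕ → M) : ∃ φ : R[X] →ₗ[R] M, ∀ n, φ (X ^ n) = g n := by
  refine ⟨(basisMonomials R).constr R g, fun n => ?_⟩
  rw [← monomial_one_right_eq_X_pow, ← congrFun (coe_basisMonomials R) n,
    Module.Basis.constr_basis]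

theorem exists_isInfFreeAddConv_dirac_zero (hμ : IsLawWithMoments μ) (μ' ν' : ℝ[X] →ₗ[ℝ] ℝ) :
    ∃ γ', IsInfFreeAddConv μ μ' (Measure.dirac 0) ν' μ γ' := by
  obtain ⟨γ', hγ'⟩ := exists_linearMap_X_pow_eq (R := ℝ) fun n => ncDeriv (cumulantSeq (mom μ))
    (infCumulant μ μ' + infCumulant (Measure.dirac 0) ν') (Finset.range n)
  refine ⟨γ', ⟨hμ, fun n hn => ?_⟩, ?_, fun n hn => ?_⟩
  · rw [mom_dirac_zero, freeCumulant_single (Nat.one_le_iff_ne_zero.1 hn), add_zero]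
  · rw [← pow_zero X, hγ', Finset.range_zero, ncDeriv_empty]
  · exact infFreeCumulant_eq_of_forall_eq_ncDeriv (fun n _ => hγ' n)
      (Nat.one_le_iff_ne_zero.1 hn)

theorem IsFreeAddConv.cumulantSeq_eq (hγ : IsFreeAddConv μ (Measure.dirac 0) γ) :
    cumulantSeq (mom γ) = cumulantSeq (mom μ) := by
  ext n
  rcases eq_or_ne n 0 with rfl | hn
  · rw [cumulantSeq_zero, cumulantSeq_zero]
  · rw [cumulantSeq_of_ne_zero _ hn, cumulantSeq_of_ne_zero _ hn,
      hγ.cumulant_add n (Nat.one_le_iff_ne_zero.2 hn), mom_dirac_zero, freeCumulant_single hn,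
      add_zero]

theorem IsFreeAddConv.mom_eq (hγ : IsFreeAddConv μ (Measure.dirac 0) γ)
    (hμ : IsLawWithMoments μ) : mom γ = mom μ := by
  ext n
  rcases eq_or_ne n 0 with rfl | hn
  · rw [hγ.law.mom_zero, hμ.mom_zero]
  · rw [moment_eq_ncSum (mom γ) hn, hγ.cumulantSeq_eq, ← moment_eq_ncSum (mom μ) hn]

theorem IsInfFreeAddConv.infCumulantSeq_eq {ν : Measure ℝ} (hγ : IsInfFreeAddConv μ μ' ν ν' γ γ') :
    infCumulantSeq (mom γ) (fun k => γ' (X ^ k)) =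
      infCumulantSeq (mom μ) (fun k => μ' (X ^ k)) +
        infCumulantSeq (mom ν) (fun k => ν' (X ^ k)) := by
  ext n
  rcases eq_or_ne n 0 with rfl | hn
  · simp [infCumulantSeq_zero]
  · rw [Pi.add_apply, infCumulantSeq_of_ne_zero _ _ hn, infCumulantSeq_of_ne_zero _ _ hn,
      infCumulantSeq_of_ne_zero _ _ hn]
    exact hγ.cumulant_add n (Nat.one_le_iff_ne_zero.2 hn)

theorem IsInfFreeAddConv.apply_X_pow (hγ : IsInfFreeAddConv μ μ' (Measure.dirac 0) ν' γ γ')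
    {n : ℕ} (hn : n ≠ 0) : γ' (X ^ n) = μ' (X ^ n) + ncDeriv (cumulantSeq (mom μ))
      (infCumulantSeq (mom (Measure.dirac 0)) fun k => ν' (X ^ k)) (Finset.range n) := by
  rw [infMoment_eq_ncDeriv (mom γ) (fun k => γ' (X ^ k)) hn, hγ.freeAddConv.cumulantSeq_eq,
    hγ.infCumulantSeq_eq, ncDeriv_add, ← infMoment_eq_ncDeriv (mom μ) (fun k => μ' (X ^ k)) hn]

theorem HasLimitingDistribution.tendsto_powerSumSeries (hp : HasLimitingDistribution p μ) :
    Tendsto (fun d : ℕ => 1 + PowerSeries.C (1 / (d : ℝ)) *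
      (PowerSeries.X * powerSumSeries (p d).roots)) atTop
      (𝓝 (ncSeries (cumulantSeq (mom μ)))) := by
  rw [ncSeries_cumulantSeq hp.law.mom_zero]
  refine (PowerSeries.WithPiTopology.tendsto_iff_coeff_tendsto ℝ _ _ _).2 fun n => ?_
  rw [PowerSeries.coeff_mk]
  cases n with
  | zero => simp [hp.law.mom_zero]
  | succ n =>
    refine (hp.tendsto (n + 1)).congr' ?_
    filter_upwards [eventually_ge_atTop 1] with d hd
    rw [(hp.realRooted d hd).mom_succ, map_add, PowerSeries.coeff_C_mul,
      PowerSeries.coeff_succ_X_mul, PowerSeries.coeff_one, if_neg n.succ_ne_zero, zero_add]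

theorem HasInfinitesimalDistribution.tendsto_powerSumSeries
    (hq : HasInfinitesimalDistribution q (Measure.dirac 0) ν') :
    Tendsto (fun d => powerSumSeries (q d).roots) atTop (𝓝 (PowerSeries.mk fun n =>
      infCumulantSeq (mom (Measure.dirac 0)) (fun k => ν' (X ^ k)) (n + 1))) := by
  refine (PowerSeries.WithPiTopology.tendsto_iff_coeff_tendsto ℝ _ _ _).2 fun n => ?_
  rw [PowerSeries.coeff_mk, infCumulantSeq_of_ne_zero _ _ n.succ_ne_zero, mom_dirac_zero,
    infFreeCumulant_single _ n.succ_ne_zero]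
  refine (hq.tendsto (n + 1)).congr' ?_
  filter_upwards [eventually_ge_atTop 1] with d hd
  rw [mom_dirac_zero, Pi.single_eq_of_ne n.succ_ne_zero, sub_zero,
    (hq.limiting.realRooted d hd).mul_mom_succ (Nat.one_le_iff_ne_zero.1 hd)]

theorem HasInfinitesimalDistribution.tendsto_of_tendsto_powerSumSeries_sub
    (hp : HasInfinitesimalDistribution p μ μ') (hs : ∀ d, 1 ≤ d → IsMonicRealRooted d (s d))
    {K : PowerSeries ℝ}
    (hK : Tendsto (fun d => powerSumSeries (s d).roots - powerSumSeries (p d).roots) atTop (𝓝 K))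
    (n : ℕ) :
    Tendsto (fun d : ℕ => (d : ℝ) * (mom (rootDistribution (s d)) (n + 1) - mom μ (n + 1))) atTop
      (𝓝 (μ' (X ^ (n + 1)) + PowerSeries.coeff n K)) := by
  have hcoeff := (PowerSeries.WithPiTopology.tendsto_iff_coeff_tendsto ℝ _ _ _).1 hK n
  refine ((hp.tendsto (n + 1)).add hcoeff).congr' ?_
  filter_upwards [eventually_ge_atTop 1] with d hd
  have hd₀ := Nat.one_le_iff_ne_zero.1 hd
  rw [map_sub, ← (hs d hd).mul_mom_succ hd₀, ← (hp.limiting.realRooted d hd).mul_mom_succ hd₀]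
  ring

theorem tendsto_of_tendsto_natCast_mul_sub {u : ℕ → ℝ} {a b : ℝ}
    (h : Tendsto (fun d : ℕ => (d : ℝ) * (u d - a)) atTop (𝓝 b)) : Tendsto u atTop (𝓝 a) := by
  have hmul := ((tendsto_one_div_atTop_nhds_zero_nat (𝕜 := ℝ)).mul h).add_const a
  rw [zero_mul, zero_add] at hmul
  refine hmul.congr' ?_
  filter_upwards [eventually_ge_atTop 1] with d hd
  rw [← mul_assoc, one_div_mul_cancel (Nat.cast_ne_zero.2 (Nat.one_le_iff_ne_zero.1 hd)), one_mul,
    sub_add_cancel]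

theorem HasInfinitesimalDistribution.of_tendsto (hs : ∀ d, 1 ≤ d → IsMonicRealRooted d (s d))
    (hγ : IsLawWithMoments γ) (hγ' : γ' 1 = 0)
    (h : ∀ n : ℕ, Tendsto (fun d : ℕ => (d : ℝ) *
      (mom (rootDistribution (s d)) (n + 1) - mom γ (n + 1))) atTop (𝓝 (γ' (X ^ (n + 1))))) :
    HasInfinitesimalDistribution s γ γ' := by
  have hall : ∀ n : ℕ, Tendsto (fun d : ℕ => (d : ℝ) *
      (mom (rootDistribution (s d)) n - mom γ n)) atTop (𝓝 (γ' (X ^ n))) := by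
    rintro (_ | n)
    · rw [pow_zero, hγ']
      refine tendsto_const_nhds.congr' ?_
      filter_upwards [eventually_ge_atTop 1] with d hd
      rw [(hs d hd).mom_zero (Nat.one_le_iff_ne_zero.1 hd), hγ.mom_zero, sub_self, mul_zero]
    · exact h n
  exact ⟨⟨hs, hγ, fun n => tendsto_of_tendsto_natCast_mul_sub (hall n)⟩, hall⟩

theorem HasInfinitesimalDistribution.addConv (hp : HasInfinitesimalDistribution p μ μ')
    (hq : HasInfinitesimalDistribution q (Measure.dirac 0) ν')
    (hγ : IsInfFreeAddConv μ μ' (Measure.dirac 0) ν' γ γ') :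
    HasInfinitesimalDistribution (fun d => FiniteFree.addConv d (p d) (q d)) γ γ' := by
  have hpr := hp.limiting.realRooted
  have hqr := hq.limiting.realRooted
  have hs := fun d (hd : 1 ≤ d) => (hpr d hd).addConv (hqr d hd)
  have hK := tendsto_powerSumSeries_addConv_sub hpr hqr (cumulantSeq_zero _)
    (infCumulantSeq_zero _ _) hp.limiting.tendsto_powerSumSeries hq.tendsto_powerSumSeries
  refine .of_tendsto hs hγ.freeAddConv.law hγ.map_one fun n => ?_
  rw [hγ.freeAddConv.mom_eq hp.limiting.law, hγ.apply_X_pow n.succ_ne_zero]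
  simpa only [PowerSeries.coeff_mk] using hp.tendsto_of_tendsto_powerSumSeries_sub hs hK n

end InfinitesimalConvolution

end FiniteFree

theorem mainTheorem10 (p q : ℕ → ℝ[X]) (μ ν : Measure ℝ) (μ' ν' : ℝ[X] →ₗ[ℝ] ℝ)
    (hp : FiniteFree.HasInfinitesimalDistribution p μ μ')
    (hq : FiniteFree.HasInfinitesimalDistribution q ν ν')
    (hν : ν = Measure.dirac 0) :
    (∃ (γ : Measure ℝ) (γ' : ℝ[X] →ₗ[ℝ] ℝ), FiniteFree.IsInfFreeAddConv μ μ' ν ν' γ γ') ∧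
    ∀ (γ : Measure ℝ) (γ' : ℝ[X] →ₗ[ℝ] ℝ), FiniteFree.IsInfFreeAddConv μ μ' ν ν' γ γ' →
      FiniteFree.HasInfinitesimalDistribution
        (fun d => FiniteFree.addConv d (p d) (q d)) γ γ' := by
  subst hν
  exact ⟨⟨μ, FiniteFree.exists_isInfFreeAddConv_dirac_zero hp.limiting.law μ' ν'⟩,
    fun _ _ hγ => hp.addConv hq hγ⟩
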